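/- Let $d\ge 0$ be an integer, let $\mathcal N\subset\mathbb R^d$ be a compact neighborhood of the origin, and let $A,\phi:\mathcal N\to\mathbb C$ be (real-)analytic on $\mathcal N$. Suppose that $\operatorname{Re}\phi\ge 0$ on $\mathcal N$, with $\operatorname{Re}\phi(x)=0$ only at $x=0$ (and $\operatorname{Re}\phi(0)=0$), that the origin is a critical point of $\phi$, i.e. $d\phi(0)=0$, and that the Hessian matrix $\mathcal H=\bigl(\partial^2\phi/\partial x_i\partial x_j(0)\bigr)_{1\le i,j\le d}$ is nonsingular. For real $\lambda>0$ put $$\mathcal I(\lambda)=\int_{\mathcal N}A(x)\,e^{-\lambda\phi(x)}\,dx ,$$ where $dx$ is Lebesgue measure. Then there are complex numbers $c_0,c_1,c_2,\dots$ such that, as $\lambda\to+\infty$, $$\mathcal I(\lambda)\sim e^{-\lambda\phi(0)}\sum_{\ell\ge 0}c_\ell\,\lambda^{-d/2-\ell},$$ that is, for every integer $N\ge 0$, $$\mathcal I(\lambda)-e^{-\lambda\phi(0)}\sum_{\ell=0}^{N-1}c_\ell\,\lambda^{-d/2-\ell}=O\bigl(e^{-\lambda\phi(0)}\lambda^{-d/2-N}\bigr)\qquad(\lambda\to+\infty),$$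 and $$c_0=A(0)\,\frac{(2\pi)^{d/2}}{\sqrt{\det\mathcal H}},$$ where $\sqrt{\det\mathcal H}$ denotes the product of the principal square roots of the eigenvalues of $\mathcal H$, counted with algebraic multiplicity. (The factor $e^{-\lambda\phi(0)}$ has modulus $1$, and equals $1$ when $\phi(0)=0$.) -/

import Mathlib

open Filter Topology MeasureTheory

/-- `I(λ) ∼ ∑ₙ cₙ gₙ(λ)` as the positive real parameter `λ` tends to `∞`: for every `N`, the
remainder after the terms `n < N` is `O(g_N(λ))`.  The series itself need not converge. -/
def HasAsymptoticSeries (I : ℝ → ℂ) (c : ℕ → ℂ) (g : ℕ → ℝ → ℂ) : Prop :=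
  ∀ N : ℕ, (fun t : ℝ => I t - ∑ n ∈ Finset.range N, c n * g n t) =O[atTop] g N

/-- The partial derivative `∂f/∂xᵢ` of a complex-valued function on `ℝᵈ`. -/
noncomputable def partialDeriv {d : ℕ} (i : Fin d) (f : EuclideanSpace ℝ (Fin d) → ℂ)
    (x : EuclideanSpace ℝ (Fin d)) : ℂ :=
  fderiv ℝ f x (EuclideanSpace.single i (1 : ℝ))

/-- The Hessian matrix `(∂²f/∂xᵢ∂xⱼ)(x)` of a complex-valued function on `ℝᵈ`. -/
noncomputable def hessianMatrix {d : ℕ} (f : EuclideanSpace ℝ (Fin d) → ℂ)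
    (x : EuclideanSpace ℝ (Fin d)) : Matrix (Fin d) (Fin d) ℂ :=
  Matrix.of fun i j => partialDeriv i (partialDeriv j f) x

/-- The product of the principal square roots of the eigenvalues of a complex matrix, the
eigenvalues being the roots of its characteristic polynomial listed with multiplicity.  It is
a square root of the determinant. -/
noncomputable def sqrtDet {d : ℕ} (H : Matrix (Fin d) (Fin d) ℂ) : ℂ :=
  (H.charpoly.roots.map fun μ : ℂ => μ ^ (1 / 2 : ℂ)).prod

/-- The integral `∫_𝒩 A(x) e^{-t φ(x)} dx` against Lebesgue measure on `ℝᵈ`. -/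
noncomputable def phaseIntegral {d : ℕ} (𝒩 : Set (EuclideanSpace ℝ (Fin d)))
    (A φ : EuclideanSpace ℝ (Fin d) → ℂ) (t : ℝ) : ℂ :=
  ∫ x in 𝒩, A x * Complex.exp (-(t : ℂ) * φ x)

/-!
The expansion is obtained from integration by parts alone, without contour deformation, the Morse
lemma or Gaussian integrals with complex matrices.

Subtract `φ 0` from the phase and join it to `‖x‖²/2` by the linear deformation
`Φ(τ, x) = (1 - τ) ‖x‖²/2 + τ φ(x)`.  The real part of `Φ(τ, ·)` stays nonnegative, and positive
off the origin.  Its Hessian matrix at the origin is `(1 - τ) I + τ H`, which stays nonsingular: as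
`Re H` is positive semidefinite and `H` is symmetric, the eigenvalues of `H` lie in the closed right
half-plane, and none of them is zero.  By compactness, everything takes place in one ball around
the origin, on which the coordinates are smooth combinations of the partial derivatives of
`Φ(τ, ·)`, for all `τ` at once; outside, the integrals are exponentially small.

Let `J(u)` be the integral of a fixed cut-off function times `u(τ, x) exp(-t Φ(τ, x))`.  Hadamard's
lemma writes `u(τ, x) - u(τ, 0)` as a combination of the coordinates, hence of the partial
derivatives of `Φ`, so integration by parts gives `J(u) = u(τ, 0) J(1) + J(u') / t` up to an
exponentially small error (`PhaseFamily.exists_reduction`).  By iteration, `J(u)` is `J(1)` times a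
polynomial in `1/t` up to `O(t⁻ᴺ)`, uniformly in `τ` (`PhaseFamily.exists_expansion`).

Since `∂Φ/∂τ` vanishes to second order at the origin, the same reduction turns
`∂J(1)/∂τ = -t J(∂Φ/∂τ)` into a linear differential equation for `J(1)` whose coefficient is a
polynomial in `1/t`, and its solution compares `J(1)` at `τ = 1` with the Gaussian integral at
`τ = 0` (`PhaseFamily.exists_transport`).  The leading coefficient of the equation is
`-tr(((1 - τ) I + τ H)⁻¹ (H - I)) / 2`, which by Jacobi's formula is the logarithmic derivative of
`det((1 - τ) I + τ H)^(-1/2)`.  The path of each eigenvalue avoids the negative real axis, so that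
its principal square root varies continuously along the deformation; this identifies the branch of
the square root in the leading coefficient (`exp_integral_trace`).
-/

open scoped ContDiff

/-! ### Hadamard's lemma with a parameter -/

/-- Euclidean space `ℝᵈ`. -/
abbrev Space (d : ℕ) : Type := EuclideanSpace ℝ (Fin d)

/-- The partial derivative `∂u/∂xₖ` of a function `u(τ, x)` on `ℝ × ℝᵈ`. -/
noncomputable def pderiv {d : ℕ} (k : Fin d) (u : ℝ × Space d → ℂ) (p : ℝ × Space d) : ℂ :=
  fderiv ℝ u p (0, EuclideanSpace.single k (1 : ℝ))

section Hadamard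

variable {d : ℕ}

theorem contDiff_intervalIntegral {P : Type} [NormedAddCommGroup P] [NormedSpace ℝ P]
    {f : P → ℝ → ℂ} (hf : ContDiff ℝ ∞ (fun q : P × ℝ => f q.1 q.2)) :
    ContDiff ℝ ∞ (fun p => ∫ s in (0 : ℝ)..1, f p s) := by
  -- The integral is the value at `0` of a convolution of the indicator function of `[0, 1]` with
  -- a cut-off of `f p (-s)`, so smoothness of convolutions with parameters applies.
  let η : ContDiffBump (0 : ℝ) := ⟨2, 3, by norm_num, by norm_num⟩
  let g : P → ℝ → ℂ := fun p y => (η y : ℂ) * f p (-y)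
  have hg : ContDiff ℝ ∞ (fun q : P × ℝ => g q.1 q.2) := by
    have h1 : ContDiff ℝ ∞ (fun q : P × ℝ => ((η q.2 : ℝ) : ℂ)) :=
      Complex.ofRealCLM.contDiff.comp (η.contDiff.comp contDiff_snd)
    exact h1.mul (hf.comp (contDiff_fst.prodMk contDiff_snd.neg))
  have hind : LocallyIntegrable (Set.indicator (Set.Ioc (0 : ℝ) 1) (fun _ => (1 : ℝ))) volume :=
    (locallyIntegrable_const (1 : ℝ)).indicator measurableSet_Ioc
  have key := contDiffOn_convolution_right_with_param_comp (n := ⊤)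
    (ContinuousLinearMap.lsmul ℝ ℝ (E := ℂ)) (s := (Set.univ : Set P))
    (v := fun _ : P => (0 : ℝ)) contDiffOn_const (g := g) (k := Metric.closedBall (0 : ℝ) 3)
    isOpen_univ (isCompact_closedBall _ _) ?_ hind hg.contDiffOn
  · rw [contDiffOn_univ] at key
    convert! key using 2 with p
    rw [convolution_def, intervalIntegral.integral_of_le zero_le_one,
      ← integral_indicator measurableSet_Ioc]
    congr 1 with s
    by_cases hs : s ∈ Set.Ioc (0 : ℝ) 1
    · have : η (-s) = 1 := by
        apply η.one_of_mem_closedBall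
        simp only [Metric.mem_closedBall, dist_zero_right, norm_neg, Real.norm_eq_abs, η]
        rw [abs_of_pos hs.1]; linarith [hs.2]
      simp [hs, g, this]
    · simp [hs]
  · intro p x _ hx
    have : η x = 0 := by
      apply η.zero_of_le_dist
      simp only [Metric.mem_closedBall, not_le] at hx
      exact hx.le
    simp [g, this]

theorem pderiv_contDiff {u : ℝ × Space d → ℂ} (hu : ContDiff ℝ ∞ u) (k : Fin d) :
    ContDiff ℝ ∞ (pderiv k u) :=
  (hu.fderiv_right (m := ∞) (by simp)).clm_apply contDiff_const

theorem hasFDerivAt_slice {u : ℝ × Space d → ℂ} (hu : ContDiff ℝ ∞ u) (τ : ℝ) (x : Space d) :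
    HasFDerivAt (fun y => u (τ, y))
      ((fderiv ℝ u (τ, x)).comp (ContinuousLinearMap.inr ℝ ℝ (Space d))) x :=
  ((hu.differentiable (by simp)) (τ, x)).hasFDerivAt.comp x (hasFDerivAt_prodMk_right τ x)

theorem fderiv_slice {u : ℝ × Space d → ℂ} (hu : ContDiff ℝ ∞ u) (τ : ℝ) (x : Space d)
    (k : Fin d) :
    fderiv ℝ (fun y => u (τ, y)) x (EuclideanSpace.single k 1) = pderiv k u (τ, x) := by
  rw [(hasFDerivAt_slice hu τ x).fderiv]
  simp [pderiv]

theorem contDiff_coord (j : Fin d) : ContDiff ℝ ∞ (fun p : ℝ × Space d => ((p.2 j : ℝ) : ℂ)) :=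
  Complex.ofRealCLM.contDiff.comp ((EuclideanSpace.proj (𝕜 := ℝ) j).contDiff.comp contDiff_snd)

theorem pderiv_coord (j k : Fin d) (p : ℝ × Space d) :
    pderiv k (fun p : ℝ × Space d => ((p.2 j : ℝ) : ℂ)) p = if j = k then 1 else 0 := by
  have h : HasFDerivAt (fun p : ℝ × Space d => ((p.2 j : ℝ) : ℂ))
      (Complex.ofRealCLM.comp ((EuclideanSpace.proj (𝕜 := ℝ) j).comp
        (ContinuousLinearMap.snd ℝ ℝ (Space d)))) p :=
    (Complex.ofRealCLM.comp ((EuclideanSpace.proj (𝕜 := ℝ) j).comp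
        (ContinuousLinearMap.snd ℝ ℝ (Space d)))).hasFDerivAt
  rw [pderiv, h.fderiv]
  simp
  split_ifs <;> simp

theorem pderiv_mul {u v : ℝ × Space d → ℂ} (hu : ContDiff ℝ ∞ u) (hv : ContDiff ℝ ∞ v)
    (k : Fin d) (p : ℝ × Space d) :
    pderiv k (fun p => u p * v p) p = u p * pderiv k v p + v p * pderiv k u p := by
  have h := ((hu.differentiable (by simp)) p).hasFDerivAt.mul
    ((hv.differentiable (by simp)) p).hasFDerivAt
  rw [pderiv, show (fun p => u p * v p) = u * v from rfl, h.fderiv]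
  simp [pderiv]

theorem pderiv_sum {ι : Type*} (s : Finset ι) {u : ι → ℝ × Space d → ℂ}
    (hu : ∀ i, ContDiff ℝ ∞ (u i)) (k : Fin d) (p : ℝ × Space d) :
    pderiv k (fun p => ∑ i ∈ s, u i p) p = ∑ i ∈ s, pderiv k (u i) p := by
  have h := HasFDerivAt.fun_sum (u := s)
    fun i _ => ((hu i).differentiable (by simp) p).hasFDerivAt
  rw [pderiv, h.fderiv]
  simp [pderiv]

/-- **Hadamard's lemma** with a parameter: a smooth function vanishes at the origin modulo the
coordinates, with smooth coefficients. -/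
theorem exists_hadamard {u : ℝ × Space d → ℂ} (hu : ContDiff ℝ ∞ u) :
    ∃ v : Fin d → ℝ × Space d → ℂ, (∀ j, ContDiff ℝ ∞ (v j)) ∧
      ∀ τ x, u (τ, x) = u (τ, 0) + ∑ j, (x j : ℂ) * v j (τ, x) := by
  refine ⟨fun j p => ∫ s in (0 : ℝ)..1, pderiv j u (p.1, s • p.2), fun j => ?_, fun τ x => ?_⟩
  · refine contDiff_intervalIntegral
      (f := fun (p : ℝ × Space d) s => pderiv j u (p.1, s • p.2)) ((pderiv_contDiff hu j).comp ?_)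
    fun_prop
  · have hd : ∀ s : ℝ, HasDerivAt (fun s : ℝ => u (τ, s • x))
        (∑ j, (x j : ℂ) * pderiv j u (τ, s • x)) s := by
      intro s
      have h1 : HasDerivAt (fun s : ℝ => s • x) x s := by
        simpa using (hasDerivAt_id s).smul_const x
      have h2 := (hasFDerivAt_slice hu τ (s • x)).comp_hasDerivAt s h1
      convert! h2 using 1
      conv_rhs => arg 2; rw [← (EuclideanSpace.basisFun (Fin d) ℝ).sum_repr x]
      rw [map_sum]
      simp [pderiv]
    have hc : ∀ j, Continuous fun s : ℝ => (x j : ℂ) * pderiv j u (τ, s • x) := fun j =>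
      continuous_const.mul ((pderiv_contDiff hu j).continuous.comp (by fun_prop))
    have := intervalIntegral.integral_eq_sub_of_hasDerivAt (fun s _ => hd s)
      ((continuous_finsetSum _ fun j _ => hc j).intervalIntegrable 0 1)
    rw [intervalIntegral.integral_finsetSum fun j _ => (hc j).intervalIntegrable 0 1] at this
    simp only [intervalIntegral.integral_const_mul, one_smul, zero_smul] at this
    rw [this]; ring

/-- The gradient of `∑ⱼ xⱼ vⱼ`. -/
theorem pderiv_sum_coord_mul {v : Fin d → ℝ × Space d → ℂ} (hv : ∀ j, ContDiff ℝ ∞ (v j))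
    (k : Fin d) (p : ℝ × Space d) :
    pderiv k (fun p => ∑ j, ((p.2 j : ℝ) : ℂ) * v j p) p =
      v k p + ∑ j, (p.2 j : ℂ) * pderiv k (v j) p := by
  rw [pderiv_sum _ fun j => (contDiff_coord j).mul (hv j)]
  simp_rw [pderiv_mul (contDiff_coord _) (hv _), pderiv_coord]
  rw [Finset.sum_add_distrib, add_comm]
  simp

/-- At the origin, the second derivatives of `∑ⱼ xⱼ vⱼ` are twice the symmetrized first derivatives
of the coefficients. -/
theorem pderiv_pderiv_sum_coord_mul {v : Fin d → ℝ × Space d → ℂ}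
    (hv : ∀ j, ContDiff ℝ ∞ (v j)) (k l : Fin d) (τ : ℝ) :
    pderiv k (pderiv l fun p => ∑ j, ((p.2 j : ℝ) : ℂ) * v j p) (τ, 0) =
      pderiv k (v l) (τ, 0) + pderiv l (v k) (τ, 0) := by
  have h : (pderiv l fun p => ∑ j, ((p.2 j : ℝ) : ℂ) * v j p) =
      fun p => v l p + ∑ j, (p.2 j : ℂ) * pderiv l (v j) p :=
    funext fun p => pderiv_sum_coord_mul hv l p
  have h2 : ContDiff ℝ ∞ fun p : ℝ × Space d => ∑ j, (p.2 j : ℂ) * pderiv l (v j) p :=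
    ContDiff.sum fun j _ => (contDiff_coord j).mul (pderiv_contDiff (hv j) l)
  have h3 := (((hv l).differentiable (by simp)) (τ, 0)).hasFDerivAt.add
    ((h2.differentiable (by simp)) (τ, 0)).hasFDerivAt
  have h4 := pderiv_sum_coord_mul (fun j => pderiv_contDiff (hv j) l) k (τ, 0)
  rw [h]
  rw [pderiv] at h4 ⊢
  rw [show (fun p => v l p + ∑ j, (p.2 j : ℂ) * pderiv l (v j) p) =
    v l + fun p => ∑ j, (p.2 j : ℂ) * pderiv l (v j) p from rfl, h3.fderiv]
  simp only [add_apply, h4]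
  simp [pderiv]

end Hadamard

/-! ### Reduction of amplitudes by integration by parts -/

/-- A smooth family `Φ(τ, x)`, `0 ≤ τ ≤ 1`, of phases on the ball `‖x‖ ≤ R`, together with a cut-off
function.  The real part of each phase is nonnegative on that ball, and at least `ε` on the annulus
`r ≤ ‖x‖ ≤ R` where the cut-off function varies.  That only the origin can be a critical point, and
then a nondegenerate one, is encoded in `coord_eq`: the coordinates are combinations of the partial
derivatives of the phase, with smooth coefficients. -/
structure PhaseFamily (d : ℕ) where
  phase : ℝ × Space d → ℂ
  cutoff : Space d → ℂ
  coeff : Fin d → Fin d → ℝ × Space d → ℂ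
  (r R ε : ℝ)
  phase_contDiff : ContDiff ℝ ∞ phase
  cutoff_contDiff : ContDiff ℝ ∞ cutoff
  coeff_contDiff : ∀ j k, ContDiff ℝ ∞ (coeff j k)
  cutoff_eq_zero : ∀ x, R < ‖x‖ → cutoff x = 0
  cutoff_eq_one : ∀ x, ‖x‖ ≤ r → cutoff x = 1
  ε_pos : 0 < ε
  re_nonneg : ∀ τ ∈ Set.Icc (0 : ℝ) 1, ∀ x, ‖x‖ ≤ R → 0 ≤ (phase (τ, x)).re
  le_re : ∀ τ ∈ Set.Icc (0 : ℝ) 1, ∀ x, r ≤ ‖x‖ → ‖x‖ ≤ R → ε ≤ (phase (τ, x)).re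
  coord_eq : ∀ τ ∈ Set.Icc (0 : ℝ) 1, ∀ x, ‖x‖ ≤ R → ∀ j,
    (x j : ℂ) = ∑ k, coeff j k (τ, x) * pderiv k phase (τ, x)

namespace PhaseFamily

variable {d : ℕ} (F : PhaseFamily d)

/-- The oscillatory integral `∫ χ(x) u(τ, x) exp(-t Φ(τ, x)) dx`. -/
noncomputable def osc (u : ℝ × Space d → ℂ) (τ t : ℝ) : ℂ :=
  ∫ x, F.cutoff x * u (τ, x) * Complex.exp (-(t : ℂ) * F.phase (τ, x))

theorem integrable_of_eq_zero {f : Space d → ℂ} (hf : Continuous f) {R : ℝ}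
    (h : ∀ x, R < ‖x‖ → f x = 0) : Integrable f := by
  apply hf.integrable_of_hasCompactSupport
  refine HasCompactSupport.of_support_subset_isCompact (isCompact_closedBall 0 R) fun x hx => ?_
  by_contra hx'
  simp only [Metric.mem_closedBall, dist_zero_right, not_le] at hx'
  exact hx (h x hx')

/-- The fundamental bound: if the real part of the phase is at least `δ` where the amplitude does
not vanish, the integral is `O(exp(-δ t))`, uniformly in `τ`. -/
theorem exists_norm_integral_le {w : ℝ × Space d → ℂ} (hw : Continuous w) {δ : ℝ}
    (hw0 : ∀ τ x, F.R < ‖x‖ → w (τ, x) = 0)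
    (hδ : ∀ τ ∈ Set.Icc (0 : ℝ) 1, ∀ x, w (τ, x) ≠ 0 → δ ≤ (F.phase (τ, x)).re) :
    ∃ C, 0 ≤ C ∧ ∀ τ ∈ Set.Icc (0 : ℝ) 1, ∀ t : ℝ, 0 ≤ t →
      ‖∫ x, w (τ, x) * Complex.exp (-(t : ℂ) * F.phase (τ, x))‖ ≤ C * Real.exp (-(δ * t)) := by
  obtain ⟨M, hM⟩ := (isCompact_Icc.prod
    (isCompact_closedBall (0 : Space d) F.R)).exists_bound_of_continuousOn
    (s := Set.Icc (0 : ℝ) 1 ×ˢ Metric.closedBall (0 : Space d) F.R) hw.continuousOn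
  refine ⟨max M 0 * volume.real (Metric.closedBall (0 : Space d) F.R), by positivity,
    fun τ hτ t ht => ?_⟩
  have hball : ∫ x, w (τ, x) * Complex.exp (-(t : ℂ) * F.phase (τ, x)) =
      ∫ x in Metric.closedBall (0 : Space d) F.R,
        w (τ, x) * Complex.exp (-(t : ℂ) * F.phase (τ, x)) := by
    rw [setIntegral_eq_integral_of_forall_compl_eq_zero]
    intro x hx
    simp only [Metric.mem_closedBall, dist_zero_right, not_le] at hx
    simp [hw0 τ x hx]
  rw [hball]
  refine (norm_setIntegral_le_of_norm_le_const (C := max M 0 * Real.exp (-(δ * t)))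
    (measure_closedBall_lt_top) fun x hx => ?_).trans (le_of_eq (by ring))
  by_cases h0 : w (τ, x) = 0
  · simp only [h0, zero_mul, norm_zero]; positivity
  · rw [norm_mul, Complex.norm_exp]
    gcongr
    · exact (hM (τ, x) ⟨hτ, hx⟩).trans (le_max_left _ _)
    · have := mul_le_mul_of_nonneg_right (hδ τ hτ x h0) ht
      simp only [Complex.mul_re, Complex.neg_re, Complex.ofReal_re, Complex.neg_im,
        Complex.ofReal_im]
      linarith

theorem exists_norm_osc_le {u : ℝ × Space d → ℂ} (hu : Continuous u) :
    ∃ C, 0 ≤ C ∧ ∀ τ ∈ Set.Icc (0 : ℝ) 1, ∀ t : ℝ, 0 ≤ t → ‖F.osc u τ t‖ ≤ C := by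
  have hc := F.cutoff_contDiff.continuous
  obtain ⟨C, hC0, hC⟩ := F.exists_norm_integral_le (w := fun p => F.cutoff p.2 * u p) (δ := 0)
    (by fun_prop) (fun τ x hx => by simp [F.cutoff_eq_zero x hx]) fun τ hτ x hx => by
      refine F.re_nonneg τ hτ x (le_of_not_gt fun h => hx ?_)
      simp [F.cutoff_eq_zero x h]
  exact ⟨C, hC0, fun τ hτ t ht => by simpa [osc] using hC τ hτ t ht⟩

theorem integrable_osc {u : ℝ × Space d → ℂ} (hu : Continuous u) (τ t : ℝ) :
    Integrable fun x => F.cutoff x * u (τ, x) * Complex.exp (-(t : ℂ) * F.phase (τ, x)) := by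
  have hc := F.cutoff_contDiff.continuous
  have hp := F.phase_contDiff.continuous
  exact integrable_of_eq_zero (by fun_prop) (R := F.R) fun x hx => by
    simp [F.cutoff_eq_zero x hx]

theorem osc_sum {ι : Type*} (s : Finset ι) {u : ι → ℝ × Space d → ℂ}
    (hu : ∀ i, Continuous (u i)) (τ t : ℝ) :
    F.osc (fun p => ∑ i ∈ s, u i p) τ t = ∑ i ∈ s, F.osc (u i) τ t := by
  simp only [osc]
  rw [← integral_finsetSum _ fun i _ => F.integrable_osc (hu i) τ t]
  simp_rw [Finset.mul_sum, Finset.sum_mul]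

theorem osc_add {u v : ℝ × Space d → ℂ} (hu : Continuous u) (hv : Continuous v) (τ t : ℝ) :
    F.osc (fun p => u p + v p) τ t = F.osc u τ t + F.osc v τ t := by
  simp only [osc]
  rw [← integral_add (F.integrable_osc hu τ t) (F.integrable_osc hv τ t)]
  simp_rw [mul_add, add_mul]

/-- Only the values of the amplitude on the ball of radius `R` matter. -/
theorem osc_congr {u v : ℝ × Space d → ℂ} {τ : ℝ} (h : ∀ x, ‖x‖ ≤ F.R → u (τ, x) = v (τ, x))
    (t : ℝ) : F.osc u τ t = F.osc v τ t := by
  refine integral_congr_ae (Eventually.of_forall fun x => ?_)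
  rcases lt_or_ge F.R ‖x‖ with hx | hx
  · simp [F.cutoff_eq_zero x hx]
  · simp [h x hx]

theorem osc_const_mul (c : ℂ) (u : ℝ × Space d → ℂ) (τ t : ℝ) :
    F.osc (fun p => c * u p) τ t = c * F.osc u τ t := by
  simp only [osc]
  rw [← integral_const_mul]
  congr 1 with x
  ring

theorem fderiv_cutoff_eq_zero_inside {x : Space d} (hx : ‖x‖ < F.r) : fderiv ℝ F.cutoff x = 0 := by
  have : F.cutoff =ᶠ[𝓝 x] fun _ => 1 := by
    filter_upwards [(isOpen_lt continuous_norm continuous_const).mem_nhds hx] with y hy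
    exact F.cutoff_eq_one y (le_of_lt hy)
  rw [this.fderiv_eq]
  simp

theorem fderiv_cutoff_eq_zero_outside {x : Space d} (hx : F.R < ‖x‖) : fderiv ℝ F.cutoff x = 0 := by
  have : F.cutoff =ᶠ[𝓝 x] fun _ => 0 := by
    filter_upwards [(isOpen_lt continuous_const continuous_norm).mem_nhds hx] with y hy
    exact F.cutoff_eq_zero y hy
  rw [this.fderiv_eq]
  simp

theorem continuous_fderiv_cutoff : Continuous (fderiv ℝ F.cutoff) :=
  F.cutoff_contDiff.continuous_fderiv (by simp)

/-- Integration by parts in the direction of `xₖ`. -/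
theorem mul_osc_mul_pderiv {v : ℝ × Space d → ℂ} (hv : ContDiff ℝ ∞ v) (k : Fin d) (τ t : ℝ) :
    t * F.osc (fun p => v p * pderiv k F.phase p) τ t = F.osc (pderiv k v) τ t +
      ∫ x, v (τ, x) * fderiv ℝ F.cutoff x (EuclideanSpace.single k 1) *
        Complex.exp (-(t : ℂ) * F.phase (τ, x)) := by
  have hp := F.phase_contDiff
  have hχ := F.cutoff_contDiff
  have hχc := hχ.continuous
  have hχ' := F.continuous_fderiv_cutoff
  have hpc := hp.continuous
  have hvc := hv.continuous
  have hdv := (pderiv_contDiff hv k).continuous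
  have hdp := (pderiv_contDiff hp k).continuous
  have hf (x : Space d) : HasFDerivAt (fun y => F.cutoff y * v (τ, y))
      (F.cutoff x • (fderiv ℝ v (τ, x)).comp (ContinuousLinearMap.inr ℝ ℝ (Space d)) +
        v (τ, x) • fderiv ℝ F.cutoff x) x :=
    ((hχ.differentiable (by simp)) x).hasFDerivAt.mul (hasFDerivAt_slice hv τ x)
  have hg (x : Space d) : HasFDerivAt (fun y => Complex.exp (-(t : ℂ) * F.phase (τ, y)))
      (Complex.exp (-(t : ℂ) * F.phase (τ, x)) • (-(t : ℂ)) •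
        (fderiv ℝ F.phase (τ, x)).comp (ContinuousLinearMap.inr ℝ ℝ (Space d))) x :=
    ((hasFDerivAt_slice hp τ x).const_mul (-(t : ℂ))).cexp
  have hf' (x : Space d) : fderiv ℝ (fun y => F.cutoff y * v (τ, y)) x
      (EuclideanSpace.single k 1) = F.cutoff x * pderiv k v (τ, x) +
        v (τ, x) * fderiv ℝ F.cutoff x (EuclideanSpace.single k 1) := by
    rw [(hf x).fderiv]; simp [pderiv]
  have hg' (x : Space d) : fderiv ℝ (fun y => Complex.exp (-(t : ℂ) * F.phase (τ, y))) x
      (EuclideanSpace.single k 1) =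
        Complex.exp (-(t : ℂ) * F.phase (τ, x)) * (-(t : ℂ) * pderiv k F.phase (τ, x)) := by
    rw [(hg x).fderiv]; simp [pderiv]
  have hi1 : Integrable fun x => F.cutoff x * pderiv k v (τ, x) *
      Complex.exp (-(t : ℂ) * F.phase (τ, x)) := F.integrable_osc hdv τ t
  have hi2 : Integrable fun x => v (τ, x) * fderiv ℝ F.cutoff x (EuclideanSpace.single k 1) *
      Complex.exp (-(t : ℂ) * F.phase (τ, x)) :=
    integrable_of_eq_zero (by fun_prop) (R := F.R) fun x hx => by
      simp [F.fderiv_cutoff_eq_zero_outside hx]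
  have key := integral_mul_fderiv_eq_neg_fderiv_mul_of_integrable (μ := volume)
    (f := fun y => F.cutoff y * v (τ, y))
    (g := fun y => Complex.exp (-(t : ℂ) * F.phase (τ, y))) (v := EuclideanSpace.single k (1 : ℝ))
    (by simp_rw [hf', add_mul]; exact hi1.add hi2)
    (by
      simp_rw [hg']
      exact integrable_of_eq_zero (by fun_prop) (R := F.R) fun x hx => by
        simp [F.cutoff_eq_zero x hx])
    (F.integrable_osc hvc τ t)
    (fun x _ => (hf x).differentiableAt) (fun x _ => (hg x).differentiableAt)
  simp_rw [hf', hg', add_mul] at key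
  rw [integral_add hi1 hi2] at key
  rw [osc, osc, ← neg_inj, neg_add, ← neg_add, ← key, ← integral_const_mul, ← integral_neg]
  congr 1 with x
  ring

/-- Against an amplitude `∑ₖ vₖ ∂ₖΦ` in the Jacobian ideal of the phase, the integral gains a
factor `1/t`. -/
theorem exists_norm_mul_osc_sub_le {v : Fin d → ℝ × Space d → ℂ}
    (hv : ∀ k, ContDiff ℝ ∞ (v k)) :
    ∃ C, 0 ≤ C ∧ ∀ τ ∈ Set.Icc (0 : ℝ) 1, ∀ t : ℝ, 0 ≤ t →
      ‖t * F.osc (fun p => ∑ k, v k p * pderiv k F.phase p) τ t -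
        F.osc (fun p => ∑ k, pderiv k (v k) p) τ t‖ ≤ C * Real.exp (-(F.ε * t)) := by
  have hχ' := F.continuous_fderiv_cutoff
  have hvc := fun k => (hv k).continuous
  have h (k : Fin d) := F.exists_norm_integral_le (δ := F.ε)
    (w := fun p => v k p * fderiv ℝ F.cutoff p.2 (EuclideanSpace.single k 1))
    (by have := hvc k; fun_prop) (fun τ x hx => by simp [F.fderiv_cutoff_eq_zero_outside hx])
    fun τ hτ x hx => F.le_re τ hτ x
      (le_of_not_gt fun h => hx (by simp [F.fderiv_cutoff_eq_zero_inside h]))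
      (le_of_not_gt fun h => hx (by simp [F.fderiv_cutoff_eq_zero_outside h]))
  choose C hC0 hC using h
  refine ⟨∑ k, C k, Finset.sum_nonneg fun k _ => hC0 k, fun τ hτ t ht => ?_⟩
  rw [F.osc_sum (u := fun k p => v k p * pderiv k F.phase p) _
      fun k => (hvc k).mul (pderiv_contDiff F.phase_contDiff k).continuous,
    F.osc_sum _ fun k => (pderiv_contDiff (hv k) k).continuous, Finset.mul_sum]
  simp_rw [F.mul_osc_mul_pderiv (hv _)]
  rw [Finset.sum_add_distrib, add_sub_cancel_left, Finset.sum_mul]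
  exact (norm_sum_le _ _).trans (Finset.sum_le_sum fun k _ => hC k τ hτ t ht)

/-- A combination of the coordinates is, on the ball of radius `R`, a combination of the partial
derivatives of the phase. -/
theorem osc_sum_coord_mul (v : Fin d → ℝ × Space d → ℂ) {τ : ℝ} (hτ : τ ∈ Set.Icc (0 : ℝ) 1)
    (t : ℝ) :
    F.osc (fun p => ∑ j, (p.2 j : ℂ) * v j p) τ t =
      F.osc (fun p => ∑ k, (∑ j, v j p * F.coeff j k p) * pderiv k F.phase p) τ t := by
  refine F.osc_congr (fun x hx => ?_) t
  simp_rw [F.coord_eq τ hτ x hx, Finset.sum_mul]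
  rw [Finset.sum_comm]
  exact Finset.sum_congr rfl fun k _ => Finset.sum_congr rfl fun j _ => by ring

/-- One step of the reduction: modulo an exponentially small error, an amplitude can be replaced by
its value at the origin plus `1/t` times another smooth amplitude. -/
theorem exists_reduction {u : ℝ × Space d → ℂ} (hu : ContDiff ℝ ∞ u) :
    ∃ u' : ℝ × Space d → ℂ, ContDiff ℝ ∞ u' ∧ ∃ C, 0 ≤ C ∧
      ∀ τ ∈ Set.Icc (0 : ℝ) 1, ∀ t : ℝ, 0 ≤ t →
        ‖t * (F.osc u τ t - u (τ, 0) * F.osc (fun _ => 1) τ t) - F.osc u' τ t‖ ≤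
          C * Real.exp (-(F.ε * t)) := by
  obtain ⟨v, hv, huv⟩ := exists_hadamard hu
  have hw : ∀ k, ContDiff ℝ ∞ fun p => ∑ j, v j p * F.coeff j k p := fun k =>
    ContDiff.sum fun j _ => (hv j).mul (F.coeff_contDiff j k)
  obtain ⟨C, hC0, hC⟩ := F.exists_norm_mul_osc_sub_le hw
  refine ⟨fun p => ∑ k, pderiv k (fun p => ∑ j, v j p * F.coeff j k p) p,
    ContDiff.sum fun k _ => pderiv_contDiff (hw k) k, C, hC0, fun τ hτ t ht => ?_⟩
  have h : F.osc u τ t =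
      u (τ, 0) * F.osc (fun _ => 1) τ t + F.osc (fun p => ∑ j, (p.2 j : ℂ) * v j p) τ t := by
    rw [← F.osc_const_mul, ← F.osc_add (u := fun _ => u (τ, 0) * 1)
      (v := fun p => ∑ j, (p.2 j : ℂ) * v j p) (by fun_prop)
      (continuous_finsetSum _ fun j _ => (contDiff_coord j).continuous.mul (hv j).continuous)]
    exact F.osc_congr (fun x _ => by rw [huv τ x, mul_one]) t
  rw [h, add_sub_cancel_left, F.osc_sum_coord_mul v hτ]
  exact hC τ hτ t ht

theorem exp_neg_le {ε t : ℝ} (hε : 0 < ε) (ht : 0 < t) (N : ℕ) :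
    Real.exp (-(ε * t)) ≤ (N.factorial / ε ^ N) * (t ^ N)⁻¹ := by
  have h := Real.pow_div_factorial_le_exp (ε * t) (by positivity) N
  rw [Real.exp_neg]
  calc (Real.exp (ε * t))⁻¹ ≤ ((ε * t) ^ N / N.factorial)⁻¹ := by gcongr
    _ = _ := by rw [mul_pow]; field_simp

/-- Iterating the reduction: relative to the integral with amplitude `1`, every oscillatory
integral has an expansion in powers of `1/t`, uniformly in `τ`. -/
theorem exists_expansion (N : ℕ) {u : ℝ × Space d → ℂ} (hu : ContDiff ℝ ∞ u) :
    ∃ b : ℕ → ℝ → ℂ, (∀ l, Continuous (b l)) ∧ (∀ τ, b 0 τ = u (τ, 0)) ∧ ∃ C, 0 ≤ C ∧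
      ∀ τ ∈ Set.Icc (0 : ℝ) 1, ∀ t : ℝ, 1 ≤ t →
        ‖F.osc u τ t - (∑ l ∈ Finset.range N, b l τ * ((t : ℂ) ^ l)⁻¹) *
          F.osc (fun _ => 1) τ t‖ ≤ C * (t ^ N)⁻¹ := by
  induction N generalizing u with
  | zero =>
    obtain ⟨C, hC0, hC⟩ := F.exists_norm_osc_le hu.continuous
    exact ⟨fun _ τ => u (τ, 0), fun _ => hu.continuous.comp (by fun_prop), fun _ => rfl, C, hC0,
      fun τ hτ t ht => by simpa using hC τ hτ t (by linarith)⟩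
  | succ N ih =>
    obtain ⟨u', hu', C₁, hC₁0, hC₁⟩ := F.exists_reduction hu
    obtain ⟨b, hb, -, C₂, hC₂0, hC₂⟩ := ih hu'
    refine ⟨fun l => Nat.casesOn l (fun τ => u (τ, 0)) b, ?_, fun _ => rfl,
      C₁ * (N.factorial / F.ε ^ N) + C₂, by have := F.ε_pos; positivity, fun τ hτ t ht => ?_⟩
    · rintro (_ | l)
      · exact hu.continuous.comp (by fun_prop)
      · exact hb l
    · have ht0 : (0 : ℝ) < t := by linarith
      have htc : (t : ℂ) ≠ 0 := by exact_mod_cast ht0.ne'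
      have h1 := (hC₁ τ hτ t ht0.le).trans
        (mul_le_mul_of_nonneg_left (exp_neg_le F.ε_pos ht0 N) hC₁0)
      have h2 := hC₂ τ hτ t ht
      rw [Finset.sum_range_succ']
      simp only [pow_zero, inv_one, mul_one]
      have h3 := (norm_add_le _ _).trans (add_le_add h1 h2)
      have h4 : t * (F.osc u τ t - (∑ l ∈ Finset.range N, b l τ * ((t : ℂ) ^ (l + 1))⁻¹ +
          u (τ, 0)) * F.osc (fun _ => 1) τ t) =
          (t * (F.osc u τ t - u (τ, 0) * F.osc (fun _ => 1) τ t) - F.osc u' τ t) +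
          (F.osc u' τ t - (∑ l ∈ Finset.range N, b l τ * ((t : ℂ) ^ l)⁻¹) *
            F.osc (fun _ => 1) τ t) := by
        have : ∑ l ∈ Finset.range N, b l τ * ((t : ℂ) ^ l)⁻¹ =
            t * ∑ l ∈ Finset.range N, b l τ * ((t : ℂ) ^ (l + 1))⁻¹ := by
          rw [Finset.mul_sum]
          exact Finset.sum_congr rfl fun l _ => by rw [pow_succ]; field_simp
        rw [this]; ring
      rw [← h4, norm_mul, Complex.norm_real, Real.norm_of_nonneg ht0.le] at h3
      rw [pow_succ, mul_inv, ← mul_assoc, ← div_eq_mul_inv, le_div_iff₀ ht0, mul_comm]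
      refine h3.trans (le_of_eq (by ring))

end PhaseFamily

/-! ### Transport along a family of phases -/

namespace PhaseFamily

variable {d : ℕ} (F : PhaseFamily d)

/-- The reduction for an amplitude with a critical zero at the origin: the value at the origin of
the new amplitude is half the contraction of the Hessian matrix of the amplitude with the inverse
of that of the phase. -/
theorem exists_reduction_of_critical {u : ℝ × Space d → ℂ} (hu : ContDiff ℝ ∞ u)
    (hu0 : ∀ τ, u (τ, 0) = 0) (hu1 : ∀ τ k, pderiv k u (τ, 0) = 0)
    (hsymm : ∀ τ ∈ Set.Icc (0 : ℝ) 1, ∀ j k, F.coeff j k (τ, 0) = F.coeff k j (τ, 0)) :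
    ∃ u' : ℝ × Space d → ℂ, ContDiff ℝ ∞ u' ∧
      (∀ τ ∈ Set.Icc (0 : ℝ) 1, u' (τ, 0) =
        (1 / 2) * ∑ j, ∑ k, F.coeff j k (τ, 0) * pderiv k (pderiv j u) (τ, 0)) ∧
      ∃ C, 0 ≤ C ∧ ∀ τ ∈ Set.Icc (0 : ℝ) 1, ∀ t : ℝ, 0 ≤ t →
        ‖t * F.osc u τ t - F.osc u' τ t‖ ≤ C * Real.exp (-(F.ε * t)) := by
  obtain ⟨v, hv, huv⟩ := exists_hadamard hu
  have hu_eq : u = fun p => ∑ j, (p.2 j : ℂ) * v j p := by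
    funext ⟨τ, x⟩
    rw [huv, hu0, zero_add]
  have hw : ∀ k, ContDiff ℝ ∞ fun p => ∑ j, v j p * F.coeff j k p := fun k =>
    ContDiff.sum fun j _ => (hv j).mul (F.coeff_contDiff j k)
  have hv0 : ∀ τ k, v k (τ, 0) = 0 := fun τ k => by
    have := hu1 τ k
    rw [hu_eq, pderiv_sum_coord_mul hv] at this
    simpa using this
  have hhess : ∀ τ k l, pderiv k (pderiv l u) (τ, 0) =
      pderiv k (v l) (τ, 0) + pderiv l (v k) (τ, 0) := fun τ k l => by
    rw [hu_eq, pderiv_pderiv_sum_coord_mul hv]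
  obtain ⟨C, hC0, hC⟩ := F.exists_norm_mul_osc_sub_le hw
  refine ⟨fun p => ∑ k, pderiv k (fun p => ∑ j, v j p * F.coeff j k p) p,
    ContDiff.sum fun k _ => pderiv_contDiff (hw k) k, fun τ hτ => ?_, C, hC0,
    fun τ hτ t ht => ?_⟩
  · have h1 : ∀ k, pderiv k (fun p => ∑ j, v j p * F.coeff j k p) (τ, 0) =
        ∑ j, F.coeff j k (τ, 0) * pderiv k (v j) (τ, 0) := fun k => by
      rw [pderiv_sum _ fun j => (hv j).mul (F.coeff_contDiff j k)]
      refine Finset.sum_congr rfl fun j _ => ?_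
      rw [pderiv_mul (hv j) (F.coeff_contDiff j k), hv0, zero_mul, zero_add]
    have h2 : ∑ j, ∑ k, F.coeff j k (τ, 0) * pderiv j (v k) (τ, 0) =
        ∑ j, ∑ k, F.coeff j k (τ, 0) * pderiv k (v j) (τ, 0) := by
      rw [Finset.sum_comm]
      exact Finset.sum_congr rfl fun j _ => Finset.sum_congr rfl fun k _ => by
        rw [hsymm τ hτ j k]
    simp_rw [h1, hhess, mul_add, Finset.sum_add_distrib]
    rw [h2, Finset.sum_comm]
    ring
  · rw [show F.osc u τ t = F.osc (fun p => ∑ j, (p.2 j : ℂ) * v j p) τ t by rw [← hu_eq],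
      F.osc_sum_coord_mul v hτ]
    exact hC τ hτ t ht

/-- Differentiation under the integral sign in the parameter `τ`. -/
theorem hasDerivAt_osc {Θ : ℝ × Space d → ℂ} (hΘ : ContDiff ℝ ∞ Θ)
    (hd : ∀ τ x, HasDerivAt (fun s : ℝ => F.phase (s, x)) (Θ (τ, x)) τ) (τ t : ℝ) :
    HasDerivAt (fun s => F.osc (fun _ => 1) s t) (-(t : ℂ) * F.osc Θ τ t) τ := by
  have hχ := F.cutoff_contDiff.continuous
  have hp := F.phase_contDiff.continuous
  have hΘc := hΘ.continuous
  let G : ℝ × Space d → ℂ := fun p =>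
    F.cutoff p.2 * (Complex.exp (-(t : ℂ) * F.phase p) * (-(t : ℂ) * Θ p))
  have hG : Continuous G := by fun_prop
  obtain ⟨M, hM⟩ := ((isCompact_closedBall τ 1).prod
    (isCompact_closedBall (0 : Space d) F.R)).exists_bound_of_continuousOn hG.continuousOn
  have hbound : Integrable (Set.indicator (Metric.closedBall (0 : Space d) F.R) fun _ => M) :=
    (integrable_indicator_iff measurableSet_closedBall).2
      (integrableOn_const measure_closedBall_lt_top.ne)
  have key := (hasDerivAt_integral_of_dominated_loc_of_deriv_le (μ := volume)
    (F := fun s x => F.cutoff x * 1 * Complex.exp (-(t : ℂ) * F.phase (s, x)))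
    (F' := fun s x => G (s, x)) (x₀ := τ) (Metric.closedBall_mem_nhds τ one_pos)
    (Eventually.of_forall fun s =>
      (F.integrable_osc (u := fun _ => 1) continuous_const s t).aestronglyMeasurable)
    (F.integrable_osc (u := fun _ => 1) continuous_const τ t)
    (Continuous.aestronglyMeasurable (by fun_prop))
    (Eventually.of_forall fun x s hs => ?_) hbound
    (Eventually.of_forall fun x s _ => ?_)).2
  · convert! key using 1
    rw [osc, ← integral_const_mul]
    congr 1 with x
    simp only [G]
    ring
  · by_cases hx : x ∈ Metric.closedBall (0 : Space d) F.R
    · rw [Set.indicator_of_mem hx]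
      exact hM (s, x) ⟨hs, hx⟩
    · rw [Set.indicator_of_notMem hx]
      simp only [Metric.mem_closedBall, dist_zero_right, not_le] at hx
      simp [G, F.cutoff_eq_zero x hx]
  · simp only [mul_one, G]
    exact (((hd s x).const_mul (-(t : ℂ))).cexp).const_mul (F.cutoff x)

/-- Transport along the family: up to `O(t⁻ᴺ)`, the integrals for `τ = 0` and `τ = 1` with
amplitude `1` differ by the exponential of a polynomial in `1/t`.  Its constant coefficient is
half the integral of the contraction of the Hessian matrix of `Θ = ∂Φ/∂τ` with the inverse of that
of the phase. -/
theorem exists_transport {Θ : ℝ × Space d → ℂ} (hΘ : ContDiff ℝ ∞ Θ)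
    (hd : ∀ τ x, HasDerivAt (fun s : ℝ => F.phase (s, x)) (Θ (τ, x)) τ)
    (hΘ0 : ∀ τ, Θ (τ, 0) = 0) (hΘ1 : ∀ τ k, pderiv k Θ (τ, 0) = 0)
    (hsymm : ∀ τ ∈ Set.Icc (0 : ℝ) 1, ∀ j k, F.coeff j k (τ, 0) = F.coeff k j (τ, 0)) (N : ℕ) :
    ∃ p : ℕ → ℂ, p 0 = ∫ τ in (0 : ℝ)..1,
        (1 / 2) * ∑ j, ∑ k, F.coeff j k (τ, 0) * pderiv k (pderiv j Θ) (τ, 0) ∧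
      ∃ C, 0 ≤ C ∧ ∀ t : ℝ, 1 ≤ t →
        ‖Complex.exp (∑ l ∈ Finset.range N, p l * ((t : ℂ) ^ l)⁻¹) * F.osc (fun _ => 1) 1 t -
          F.osc (fun _ => 1) 0 t‖ ≤ C * (t ^ N)⁻¹ := by
  obtain ⟨u, hu, hu_zero, C₁, hC₁0, hC₁⟩ := F.exists_reduction_of_critical hΘ hΘ0 hΘ1 hsymm
  obtain ⟨a, ha, ha0, C₂, hC₂0, hC₂⟩ := F.exists_expansion N hu
  -- `P l` is the primitive of the `l`-th coefficient, bounded on `[0, 1]`.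
  let P : ℕ → ℝ → ℂ := fun l τ => ∫ s in (0 : ℝ)..τ, a l s
  have hP (l : ℕ) (τ : ℝ) : HasDerivAt (P l) (a l τ) τ :=
    intervalIntegral.integral_hasDerivAt_right ((ha l).intervalIntegrable _ _)
      ((ha l).stronglyMeasurableAtFilter _ _) (ha l).continuousAt
  have hPb (l : ℕ) : ∃ M, ∀ τ ∈ Set.Icc (0 : ℝ) 1, ‖P l τ‖ ≤ M :=
    isCompact_Icc.exists_bound_of_continuousOn
      (fun τ _ => (hP l τ).continuousAt.continuousWithinAt)
  choose M hM using hPb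
  let S : ℝ → ℝ → ℂ := fun t τ => ∑ l ∈ Finset.range N, P l τ * ((t : ℂ) ^ l)⁻¹
  let A : ℝ → ℝ → ℂ := fun t τ => ∑ l ∈ Finset.range N, a l τ * ((t : ℂ) ^ l)⁻¹
  have hS (t τ : ℝ) : HasDerivAt (S t) (A t τ) τ :=
    HasDerivAt.fun_sum fun l _ => (hP l τ).mul_const _
  have hSb : ∀ t : ℝ, 1 ≤ t → ∀ τ ∈ Set.Icc (0 : ℝ) 1, ‖S t τ‖ ≤ ∑ l ∈ Finset.range N, M l := by
    intro t ht τ hτ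
    refine (norm_sum_le _ _).trans (Finset.sum_le_sum fun l _ => ?_)
    rw [norm_mul, norm_inv, norm_pow, Complex.norm_real, Real.norm_of_nonneg (by linarith)]
    exact (mul_le_of_le_one_right (norm_nonneg _)
      (inv_le_one_of_one_le₀ (one_le_pow₀ ht))).trans (hM l τ hτ)
  refine ⟨fun l => P l 1, ?_, Real.exp (∑ l ∈ Finset.range N, M l) *
    (C₁ * (N.factorial / F.ε ^ N) + C₂), ?_, fun t ht => ?_⟩
  · refine intervalIntegral.integral_congr fun τ hτ => ?_
    rw [Set.uIcc_of_le zero_le_one] at hτ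
    simp only [ha0, hu_zero τ hτ]
  · have := F.ε_pos
    positivity
  · have ht0 : 0 < t := by linarith
    have hderiv (τ : ℝ) : HasDerivAt (fun τ => Complex.exp (S t τ) * F.osc (fun _ => 1) τ t)
        (Complex.exp (S t τ) * A t τ * F.osc (fun _ => 1) τ t +
          Complex.exp (S t τ) * (-(t : ℂ) * F.osc Θ τ t)) τ :=
      (hS t τ).cexp.mul (F.hasDerivAt_osc hΘ hd τ t)
    have hle := norm_image_sub_le_of_norm_deriv_le_segment_01'
      (fun τ _ => (hderiv τ).hasDerivWithinAt) (C := Real.exp (∑ l ∈ Finset.range N, M l) *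
        (C₁ * (N.factorial / F.ε ^ N) + C₂) * (t ^ N)⁻¹) fun τ hτ => ?_
    · have hS0 : S t 0 = 0 := by simp [S, P]
      simpa [hS0] using hle
    · have hτ' : τ ∈ Set.Icc (0 : ℝ) 1 := Set.Ico_subset_Icc_self hτ
      have h1 := (hC₁ τ hτ' t ht0.le).trans
        (mul_le_mul_of_nonneg_left (exp_neg_le F.ε_pos ht0 N) hC₁0)
      have h2 := hC₂ τ hτ' t ht
      have h3 := (norm_add_le _ _).trans (add_le_add h1 h2)
      have h4 : Complex.exp (S t τ) * A t τ * F.osc (fun _ => 1) τ t +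
          Complex.exp (S t τ) * (-(t : ℂ) * F.osc Θ τ t) =
          -(Complex.exp (S t τ) * ((t * F.osc Θ τ t - F.osc u τ t) +
            (F.osc u τ t - A t τ * F.osc (fun _ => 1) τ t))) := by ring
      rw [h4, norm_neg, norm_mul, mul_assoc]
      gcongr
      · rw [Complex.norm_exp]
        exact Real.exp_le_exp.2 ((Complex.re_le_norm _).trans (hSb t ht τ hτ'))
      · exact h3.trans (le_of_eq (by ring))

end PhaseFamily

/-! ### The determinant along the segment from the identity matrix -/

section LinearAlgebra

variable {d : ℕ}

/-- The point `(1 - τ) I + τ H` of the segment from the identity matrix to `H`. -/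
noncomputable def segMatrix (H : Matrix (Fin d) (Fin d) ℂ) (τ : ℝ) : Matrix (Fin d) (Fin d) ℂ :=
  (1 - (τ : ℂ)) • (1 : Matrix (Fin d) (Fin d) ℂ) + (τ : ℂ) • H

theorem det_smul_one_add_smul (H : Matrix (Fin d) (Fin d) ℂ) (a b : ℂ) :
    (a • (1 : Matrix (Fin d) (Fin d) ℂ) + b • H).det =
      (H.charpoly.roots.map fun μ => a + b * μ).prod := by
  have hcard : H.charpoly.roots.card = d := by
    rw [← (IsAlgClosed.splits H.charpoly).natDegree_eq_card_roots,
      Matrix.charpoly_natDegree_eq_dim, Fintype.card_fin]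
  by_cases hb : b = 0
  · simp [hb, hcard]
  · have h1 : a • (1 : Matrix (Fin d) (Fin d) ℂ) + b • H =
        (-b) • (Matrix.scalar (Fin d) (-a / b) - H) := by
      rw [smul_sub, neg_smul, neg_smul, sub_neg_eq_add, Matrix.scalar_apply,
        ← Matrix.smul_one_eq_diagonal, smul_smul, ← neg_smul]
      congr 2
      field_simp
    rw [h1, Matrix.det_smul, Fintype.card_fin, ← Matrix.eval_charpoly]
    conv_lhs => rw [(IsAlgClosed.splits H.charpoly).eq_prod_roots_of_monic H.charpoly_monic]
    rw [Polynomial.eval_multiset_prod, Multiset.map_map]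
    conv_lhs => enter [1]; rw [← hcard]
    rw [← Multiset.prod_replicate, ← Multiset.map_const', ← Multiset.prod_map_mul]
    congr 1
    refine Multiset.map_congr rfl fun μ _ => ?_
    simp
    field_simp
    ring

/-- The eigenvalues of a nonsingular symmetric matrix whose real part is positive semidefinite lie
in the closed right half-plane, punctured at the origin. -/
theorem re_nonneg_and_ne_zero_of_mem_roots {H : Matrix (Fin d) (Fin d) ℂ}
    (hsymm : ∀ i j, H i j = H j i)
    (hpos : ∀ x : Fin d → ℝ, 0 ≤ ∑ i, ∑ j, x i * x j * (H i j).re) (hdet : H.det ≠ 0) {μ : ℂ}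
    (hμ : μ ∈ H.charpoly.roots) : 0 ≤ μ.re ∧ μ ≠ 0 := by
  refine ⟨?_, ?_⟩
  · have hroot := (Polynomial.mem_roots'.1 hμ).2
    rw [Polynomial.IsRoot, Matrix.eval_charpoly] at hroot
    obtain ⟨v, hv0, hv⟩ := Matrix.exists_mulVec_eq_zero_iff.2 hroot
    have hHv : ∀ i, ∑ j, H i j * v j = μ * v i := fun i => by
      have := congrFun hv i
      rw [Matrix.sub_mulVec] at this
      simp only [Matrix.scalar_apply, Pi.sub_apply, Matrix.mulVec_diagonal, Pi.zero_apply] at this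
      rw [sub_eq_zero] at this
      rw [this]; rfl
    -- Pairing with the eigenvector: the imaginary part of `H` contributes nothing to the real part,
    -- by symmetry.
    have hsum : ∑ i, ∑ j, (starRingEnd ℂ (v i) * H i j * v j).re =
        μ.re * ∑ i, Complex.normSq (v i) := by
      rw [Finset.mul_sum]
      refine Finset.sum_congr rfl fun i _ => ?_
      rw [← Complex.re_sum]
      simp_rw [mul_assoc]
      rw [← Finset.mul_sum, hHv]
      simp [Complex.normSq_apply]; ring
    have hanti : ∑ i, ∑ j, ((v i).re * (v j).im - (v i).im * (v j).re) * (H i j).im = 0 := by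
      have h : ∑ i, ∑ j, ((v i).re * (v j).im - (v i).im * (v j).re) * (H i j).im =
          -∑ i, ∑ j, ((v i).re * (v j).im - (v i).im * (v j).re) * (H i j).im := by
        conv_lhs => rw [Finset.sum_comm]
        rw [← Finset.sum_neg_distrib]
        refine Finset.sum_congr rfl fun i _ => ?_
        rw [← Finset.sum_neg_distrib]
        refine Finset.sum_congr rfl fun j _ => ?_
        rw [hsymm j i]; ring
      linarith
    have hre : ∑ i, ∑ j, (starRingEnd ℂ (v i) * H i j * v j).re =
        ∑ i, ∑ j, (v i).re * (v j).re * (H i j).re + ∑ i, ∑ j, (v i).im * (v j).im * (H i j).re -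
          ∑ i, ∑ j, ((v i).re * (v j).im - (v i).im * (v j).re) * (H i j).im := by
      simp_rw [← Finset.sum_add_distrib, ← Finset.sum_sub_distrib]
      refine Finset.sum_congr rfl fun i _ => Finset.sum_congr rfl fun j _ => ?_
      simp
      ring
    have hpos' : 0 < ∑ i, Complex.normSq (v i) := by
      obtain ⟨i, hi⟩ := Function.ne_iff.1 hv0
      exact Finset.sum_pos' (fun i _ => Complex.normSq_nonneg _)
        ⟨i, Finset.mem_univ _, Complex.normSq_pos.2 hi⟩
    have h1 := hpos fun i => (v i).re
    have h2 := hpos fun i => (v i).im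
    refine nonneg_of_mul_nonneg_left (b := ∑ i, Complex.normSq (v i)) ?_ hpos'
    rw [← hsum, hre, hanti]
    linarith
  · rintro rfl
    rw [Matrix.det_eq_prod_roots_charpoly] at hdet
    exact hdet (Multiset.prod_eq_zero hμ)

theorem seg_mem_slitPlane {μ : ℂ} (h : 0 ≤ μ.re ∧ μ ≠ 0) {τ : ℝ} (hτ : τ ∈ Set.Icc (0 : ℝ) 1) :
    1 - (τ : ℂ) + τ * μ ∈ Complex.slitPlane := by
  rw [Complex.mem_slitPlane_iff]
  simp only [Complex.add_re, Complex.sub_re, Complex.one_re, Complex.ofReal_re, Complex.mul_re,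
    Complex.ofReal_im, zero_mul, sub_zero, Complex.add_im, Complex.sub_im, Complex.one_im,
    Complex.mul_im, add_zero, sub_self, zero_add]
  have h1 : 0 ≤ τ * μ.re := mul_nonneg hτ.1 h.1
  rcases eq_or_lt_of_le hτ.2 with rfl | hτ1
  · rcases eq_or_lt_of_le h.1 with h0 | h0
    · exact Or.inr fun him => h.2 (Complex.ext h0.symm (by simpa using him))
    · left; simpa using h0
  · left; linarith

theorem segMatrix_det_ne_zero {H : Matrix (Fin d) (Fin d) ℂ}
    (hH : ∀ μ ∈ H.charpoly.roots, 0 ≤ μ.re ∧ μ ≠ 0) {τ : ℝ} (hτ : τ ∈ Set.Icc (0 : ℝ) 1) :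
    (segMatrix H τ).det ≠ 0 := by
  rw [segMatrix, det_smul_one_add_smul]
  refine Multiset.prod_ne_zero fun h => ?_
  obtain ⟨μ, hμ, h0⟩ := Multiset.mem_map.1 h
  exact Complex.slitPlane_ne_zero (seg_mem_slitPlane (hH μ hμ) hτ) h0

/-- Jacobi's formula along the segment. -/
theorem hasDerivAt_det_segMatrix (H : Matrix (Fin d) (Fin d) ℂ) {τ : ℝ}
    (hτ : (segMatrix H τ).det ≠ 0) :
    HasDerivAt (fun s => (segMatrix H s).det)
      ((segMatrix H τ).det * ((segMatrix H τ)⁻¹ * (H - 1)).trace) τ := by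
  set M := (segMatrix H τ)⁻¹ * (H - 1) with hM
  have h1 (s : ℝ) : (segMatrix H s).det =
      (segMatrix H τ).det * (1 + M.trace * ((s - τ : ℝ) : ℂ) +
        (Matrix.det (1 + (Polynomial.X : Polynomial ℂ) • M.map Polynomial.C)).divX.divX.eval
          ((s - τ : ℝ) : ℂ) * ((s - τ : ℝ) : ℂ) ^ 2) := by
    rw [← Matrix.det_one_add_smul, ← Matrix.det_mul, mul_add, mul_one, mul_smul_comm, hM,
      ← mul_assoc, Matrix.mul_nonsing_inv _ (isUnit_iff_ne_zero.2 hτ), one_mul]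
    congr 1
    simp only [segMatrix, Complex.ofReal_sub]
    module
  have h2 : HasDerivAt (fun s : ℝ => ((s - τ : ℝ) : ℂ)) 1 τ := by
    simpa using ((hasDerivAt_id τ).sub_const τ).ofReal_comp
  set q := (Matrix.det (1 + (Polynomial.X : Polynomial ℂ) • M.map Polynomial.C)).divX.divX
  have h3 := ((q.hasDerivAt ((τ - τ : ℝ) : ℂ)).comp_of_eq τ h2 rfl).mul (h2.pow 2)
  have h4 := ((((h2.const_mul M.trace).const_add 1).add h3).const_mul (segMatrix H τ).det)
  have h5 : (fun s => (segMatrix H s).det) = _ := funext h1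
  rw [h5]
  convert! h4 using 1
  simp

theorem hasDerivAt_seg_prod (s : Multiset ℂ) {τ : ℝ}
    (hs : ∀ μ ∈ s, 1 - (τ : ℂ) + τ * μ ≠ 0) :
    HasDerivAt (fun σ : ℝ => (s.map fun μ => 1 - (σ : ℂ) + σ * μ).prod)
      ((s.map fun μ => 1 - (τ : ℂ) + τ * μ).prod *
        (s.map fun μ => (μ - 1) / (1 - (τ : ℂ) + τ * μ)).sum) τ := by
  induction s using Multiset.induction with
  | empty => simpa using hasDerivAt_const τ (1 : ℂ)
  | cons μ s ih =>
    have h0 := hs μ (Multiset.mem_cons_self _ _)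
    have ih := ih fun ν hν => hs ν (Multiset.mem_cons_of_mem hν)
    have h1 : HasDerivAt (fun σ : ℝ => 1 - (σ : ℂ) + σ * μ) (μ - 1) τ := by
      have := (hasDerivAt_id τ).ofReal_comp
      convert! (this.const_sub 1).add (this.mul_const μ) using 1
      simp; ring
    simp only [Multiset.map_cons, Multiset.prod_cons, Multiset.sum_cons]
    convert! h1.mul ih using 1
    field_simp

theorem hasDerivAt_seg_log (s : Multiset ℂ) {τ : ℝ}
    (hs : ∀ μ ∈ s, 1 - (τ : ℂ) + τ * μ ∈ Complex.slitPlane) :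
    HasDerivAt (fun σ : ℝ => (s.map fun μ => Complex.log (1 - (σ : ℂ) + σ * μ)).sum)
      (s.map fun μ => (μ - 1) / (1 - (τ : ℂ) + τ * μ)).sum τ := by
  induction s using Multiset.induction with
  | empty => simpa using hasDerivAt_const τ (0 : ℂ)
  | cons μ s ih =>
    have h0 := hs μ (Multiset.mem_cons_self _ _)
    have ih := ih fun ν hν => hs ν (Multiset.mem_cons_of_mem hν)
    have h1 : HasDerivAt (fun σ : ℝ => 1 - (σ : ℂ) + σ * μ) (μ - 1) τ := by
      have := (hasDerivAt_id τ).ofReal_comp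
      convert! (this.const_sub 1).add (this.mul_const μ) using 1
      simp; ring
    simp only [Multiset.map_cons, Multiset.sum_cons]
    exact (h1.clog_real h0).add ih

theorem trace_inv_segMatrix_mul {H : Matrix (Fin d) (Fin d) ℂ}
    (hH : ∀ μ ∈ H.charpoly.roots, 0 ≤ μ.re ∧ μ ≠ 0) {τ : ℝ} (hτ : τ ∈ Set.Icc (0 : ℝ) 1) :
    ((segMatrix H τ)⁻¹ * (H - 1)).trace =
      (H.charpoly.roots.map fun μ => (μ - 1) / (1 - (τ : ℂ) + τ * μ)).sum := by
  have hdet := segMatrix_det_ne_zero hH hτ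
  have h1 := hasDerivAt_det_segMatrix H hdet
  have h2 := hasDerivAt_seg_prod H.charpoly.roots fun μ hμ =>
    Complex.slitPlane_ne_zero (seg_mem_slitPlane (hH μ hμ) hτ)
  have h3 : ∀ σ : ℝ, (H.charpoly.roots.map fun μ => 1 - (σ : ℂ) + σ * μ).prod =
      (segMatrix H σ).det := fun σ => by rw [segMatrix, det_smul_one_add_smul]
  simp_rw [h3] at h2
  exact mul_left_cancel₀ hdet (h1.unique h2)

theorem exp_half_sum_log (s : Multiset ℂ) (hs : ∀ μ ∈ s, μ ≠ 0) :
    Complex.exp (1 / 2 * (s.map Complex.log).sum) = (s.map fun μ : ℂ => μ ^ (1 / 2 : ℂ)).prod := by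
  induction s using Multiset.induction with
  | empty => simp
  | cons μ s ih =>
    simp only [Multiset.map_cons, Multiset.sum_cons, Multiset.prod_cons]
    rw [mul_add, Complex.exp_add, ih fun ν hν => hs ν (Multiset.mem_cons_of_mem hν),
      Complex.cpow_def_of_ne_zero (hs μ (Multiset.mem_cons_self _ _)), mul_comm (1 / 2)]

/-- The product of the principal square roots of the eigenvalues, as the exponential of half the
logarithmic variation of the determinant along the segment from the identity matrix. -/
theorem exp_integral_trace {H : Matrix (Fin d) (Fin d) ℂ}
    (hH : ∀ μ ∈ H.charpoly.roots, 0 ≤ μ.re ∧ μ ≠ 0) :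
    Complex.exp (∫ τ in (0 : ℝ)..1, 1 / 2 * ((segMatrix H τ)⁻¹ * (H - 1)).trace) = sqrtDet H := by
  have h1 (τ : ℝ) (hτ : τ ∈ Set.uIcc (0 : ℝ) 1) := hasDerivAt_seg_log H.charpoly.roots fun μ hμ =>
    seg_mem_slitPlane (hH μ hμ) (by rwa [Set.uIcc_of_le zero_le_one] at hτ)
  have hcont : ContinuousOn (fun τ : ℝ => (H.charpoly.roots.map fun μ =>
      (μ - 1) / (1 - (τ : ℂ) + τ * μ)).sum) (Set.uIcc 0 1) := by
    refine continuousOn_multiset_sum _ fun μ hμ => ?_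
    refine ContinuousOn.div (by fun_prop) (by fun_prop) fun τ hτ =>
      Complex.slitPlane_ne_zero (seg_mem_slitPlane (hH μ hμ) ?_)
    rwa [Set.uIcc_of_le zero_le_one] at hτ
  have h2 := intervalIntegral.integral_eq_sub_of_hasDerivAt h1 hcont.intervalIntegrable
  have h3 : ∫ τ in (0 : ℝ)..1, 1 / 2 * ((segMatrix H τ)⁻¹ * (H - 1)).trace =
      1 / 2 * ∫ τ in (0 : ℝ)..1, (H.charpoly.roots.map fun μ =>
        (μ - 1) / (1 - (τ : ℂ) + τ * μ)).sum := by
    rw [← intervalIntegral.integral_const_mul]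
    refine intervalIntegral.integral_congr fun τ hτ => ?_
    rw [Set.uIcc_of_le zero_le_one] at hτ
    simp only [trace_inv_segMatrix_mul hH hτ]
  rw [h3, h2, sqrtDet, ← exp_half_sum_log _ fun μ hμ => (hH μ hμ).2]
  simp

end LinearAlgebra

/-! ### Asymptotic expansions in powers of `1/t` -/

section AsymptoticExpansions

open Asymptotics Polynomial

theorem tendsto_ofReal_inv_atTop : Tendsto (fun t : ℝ => ((t : ℂ))⁻¹) atTop (𝓝 0) := by
  have := (Complex.continuous_ofReal.tendsto 0).comp tendsto_inv_atTop_zero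
  simpa [Function.comp_def] using this

theorem tendsto_eval_inv (q : ℂ[X]) :
    Tendsto (fun t : ℝ => q.eval ((t : ℂ)⁻¹)) atTop (𝓝 (q.coeff 0)) := by
  rw [coeff_zero_eq_eval_zero]
  exact (q.continuous.tendsto 0).comp tendsto_ofReal_inv_atTop

theorem isBigO_eval_inv (q : ℂ[X]) :
    (fun t : ℝ => q.eval ((t : ℂ)⁻¹)) =O[atTop] (fun _ => (1 : ℝ)) :=
  (tendsto_eval_inv q).isBigO_one ℝ

theorem isBigO_inv_pow_of_le {m n : ℕ} (h : m ≤ n) :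
    (fun t : ℝ => (t ^ n)⁻¹) =O[atTop] (fun t : ℝ => (t ^ m)⁻¹) := by
  refine IsBigO.of_bound 1 ?_
  filter_upwards [eventually_ge_atTop 1] with t ht
  have ht0 : 0 < t := by linarith
  rw [Real.norm_of_nonneg (by positivity), Real.norm_of_nonneg (by positivity), one_mul]
  gcongr

theorem tendsto_inv_pow_succ (n : ℕ) : Tendsto (fun t : ℝ => (t ^ (n + 1))⁻¹) atTop (𝓝 0) :=
  (tendsto_pow_atTop (by simp)).inv_tendsto_atTop

/-- Uniqueness of asymptotic coefficients. -/
theorem coeff_eq_zero_of_isBigO {N : ℕ} {q : ℂ[X]}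
    (h : (fun t : ℝ => q.eval ((t : ℂ)⁻¹)) =O[atTop] (fun t : ℝ => (t ^ N)⁻¹)) :
    ∀ l < N, q.coeff l = 0 := by
  induction N generalizing q with
  | zero => simp
  | succ N ih =>
    have h0 : q.coeff 0 = 0 :=
      tendsto_nhds_unique (tendsto_eval_inv q) (h.trans_tendsto (tendsto_inv_pow_succ N))
    have hq : q = X * q.divX := by
      conv_lhs => rw [← X_mul_divX_add q, h0, C_0, add_zero]
    have h1 : (fun t : ℝ => q.divX.eval ((t : ℂ)⁻¹)) =O[atTop] (fun t : ℝ => (t ^ N)⁻¹) := by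
      have h2 : (fun t : ℝ => (t : ℂ)) =O[atTop] (fun t : ℝ => t) :=
        IsBigO.of_bound 1 (by simp)
      refine (h2.mul h).congr' ?_ ?_
      · filter_upwards [eventually_gt_atTop 0] with t ht
        have : (t : ℂ) ≠ 0 := by exact_mod_cast ht.ne'
        conv_lhs => rw [hq]
        rw [eval_mul, eval_X]
        field_simp
      · filter_upwards [eventually_gt_atTop 0] with t ht
        rw [pow_succ]
        field_simp
    rintro (_ | l) hl
    · exact h0
    · rw [← coeff_divX]
      exact ih h1 l (by omega)

theorem eval_sub_sum_isBigO (q : ℂ[X]) (N : ℕ) :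
    (fun t : ℝ => q.eval ((t : ℂ)⁻¹) - ∑ l ∈ Finset.range N, q.coeff l * ((t : ℂ) ^ l)⁻¹) =O[atTop]
      (fun t : ℝ => (t ^ N)⁻¹) := by
  have hdvd : X ^ N ∣ q - ∑ l ∈ Finset.range N, C (q.coeff l) * X ^ l := by
    rw [X_pow_dvd_iff]
    intro m hm
    simp [coeff_X_pow, hm]
  obtain ⟨p, hp⟩ := hdvd
  have h := (IsBigO.of_bound 1 (f := fun t : ℝ => ((t : ℂ) ^ N)⁻¹) (l := atTop)
    (g := fun t : ℝ => (t ^ N)⁻¹) (by simp)).mul (isBigO_eval_inv p)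
  refine h.congr (fun t => ?_) (fun t => by simp)
  have := congrArg (eval ((t : ℂ)⁻¹)) hp
  simp only [eval_sub, eval_finsetSum, eval_mul, eval_C, eval_pow, eval_X] at this
  simp only [inv_pow] at this
  exact this.symm

/-- A function approximated to every order by polynomials in `1/t` has an asymptotic expansion. -/
theorem exists_asymptotic_coeff {f : ℝ → ℂ} {L : ℂ}
    (h : ∀ N : ℕ, ∃ q : ℂ[X], q.coeff 0 = L ∧
      (fun t : ℝ => f t - q.eval ((t : ℂ)⁻¹)) =O[atTop] (fun t : ℝ => (t ^ N)⁻¹)) :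
    ∃ c : ℕ → ℂ, c 0 = L ∧ ∀ N : ℕ,
      (fun t : ℝ => f t - ∑ l ∈ Finset.range N, c l * ((t : ℂ) ^ l)⁻¹) =O[atTop]
        (fun t : ℝ => (t ^ N)⁻¹) := by
  choose q hq0 hq using h
  refine ⟨fun l => (q (l + 1)).coeff l, hq0 1, fun N => ?_⟩
  have hcoeff : ∀ l < N, (q (l + 1)).coeff l = (q N).coeff l := fun l hl => by
    have h1 := ((hq N).trans (isBigO_inv_pow_of_le (show l + 1 ≤ N by omega))).sub (hq (l + 1))
    have h2 := coeff_eq_zero_of_isBigO (q := q (l + 1) - q N)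
      (h1.congr_left fun t => by rw [eval_sub]; ring) l (by omega)
    rwa [coeff_sub, sub_eq_zero] at h2
  refine ((hq N).add (eval_sub_sum_isBigO (q N) N)).congr_left fun t => ?_
  rw [show ∑ l ∈ Finset.range N, (q (l + 1)).coeff l * ((t : ℂ) ^ l)⁻¹ =
    ∑ l ∈ Finset.range N, (q N).coeff l * ((t : ℂ) ^ l)⁻¹ from
    Finset.sum_congr rfl fun l hl => by rw [hcoeff l (Finset.mem_range.1 hl)]]
  ring

/-- The exponential of a polynomial in `1/t` is approximated by polynomials in `1/t`. -/
theorem exists_exp_eval_sub_isBigO (p : ℂ[X]) (N : ℕ) :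
    ∃ q : ℂ[X], q.coeff 0 = Complex.exp (p.coeff 0) ∧
      (fun t : ℝ => Complex.exp (p.eval ((t : ℂ)⁻¹)) - q.eval ((t : ℂ)⁻¹)) =O[atTop]
        (fun t : ℝ => (t ^ N)⁻¹) := by
  -- One term more than needed keeps the constant coefficient right also for `N = 0`.
  refine ⟨C (Complex.exp (p.coeff 0)) *
    ∑ k ∈ Finset.range (N + 1), C ((k.factorial : ℂ)⁻¹) * (X * p.divX) ^ k, ?_, ?_⟩
  · rw [coeff_zero_eq_eval_zero]
    simp [eval_finsetSum, Finset.sum_range_succ']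
  · have hz : (fun t : ℝ => (X * p.divX).eval ((t : ℂ)⁻¹)) =O[atTop] (fun t : ℝ => t⁻¹) := by
      have := (IsBigO.of_bound 1 (f := fun t : ℝ => (t : ℂ)⁻¹) (l := atTop)
        (g := fun t : ℝ => t⁻¹) (by simp)).mul (isBigO_eval_inv p.divX)
      simpa using this
    have hz0 : Tendsto (fun t : ℝ => (X * p.divX).eval ((t : ℂ)⁻¹)) atTop (𝓝 0) := by
      have := tendsto_eval_inv (X * p.divX)
      rwa [mul_coeff_zero, coeff_X_zero, zero_mul] at this
    have h1 := (Complex.exp_sub_sum_range_isBigO_pow (N + 1)).comp_tendsto hz0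
    have h2 := ((h1.trans (hz.pow (N + 1))).const_mul_left (Complex.exp (p.coeff 0))).trans
      ((isBigO_inv_pow_of_le (Nat.le_succ N)).congr_left fun t => (inv_pow t (N + 1)).symm)
    refine h2.congr_left fun t => ?_
    have hp : p.eval ((t : ℂ)⁻¹) = p.coeff 0 + (X * p.divX).eval ((t : ℂ)⁻¹) := by
      conv_lhs => rw [← X_mul_divX_add p]
      rw [eval_add, eval_C, add_comm]
    rw [hp, Complex.exp_add]
    simp only [Function.comp_apply, eval_mul, eval_C, eval_finsetSum, eval_pow, eval_X]
    rw [mul_sub]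
    congr 2
    exact Finset.sum_congr rfl fun k _ => by rw [div_eq_inv_mul]

end AsymptoticExpansions

/-! ### Smooth auxiliary constructions and the Hessian matrix -/

section Construction

variable {d : ℕ}

theorem contDiff_comp_snd {ψ : Space d → ℂ} (hψ : ContDiff ℝ ∞ ψ) :
    ContDiff ℝ ∞ (fun p : ℝ × Space d => ψ p.2) := hψ.comp contDiff_snd

theorem pderiv_comp_snd {ψ : Space d → ℂ} (hψ : ContDiff ℝ ∞ ψ) (k : Fin d) :
    pderiv k (fun p : ℝ × Space d => ψ p.2) = fun p => partialDeriv k ψ p.2 := by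
  funext ⟨τ, x⟩
  rw [← fderiv_slice (contDiff_comp_snd hψ), partialDeriv]

theorem partialDeriv_contDiff {ψ : Space d → ℂ} (hψ : ContDiff ℝ ∞ ψ) (k : Fin d) :
    ContDiff ℝ ∞ (partialDeriv k ψ) :=
  (hψ.fderiv_right (m := ∞) (by simp)).clm_apply contDiff_const

theorem pderiv_pderiv_comp_snd {ψ : Space d → ℂ} (hψ : ContDiff ℝ ∞ ψ) (j k : Fin d) (τ : ℝ) :
    pderiv j (pderiv k fun p : ℝ × Space d => ψ p.2) (τ, 0) = hessianMatrix ψ 0 j k := by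
  rw [pderiv_comp_snd hψ, pderiv_comp_snd (partialDeriv_contDiff hψ k), hessianMatrix,
    Matrix.of_apply]

/-- Partial derivatives in `x` commute with multiplication by functions of `τ`. -/
theorem pderiv_linearCombination {u w : ℝ × Space d → ℂ} {a b : ℝ → ℂ} (hu : ContDiff ℝ ∞ u)
    (hw : ContDiff ℝ ∞ w) (ha : ContDiff ℝ ∞ a) (hb : ContDiff ℝ ∞ b) (k : Fin d) :
    pderiv k (fun p => a p.1 * u p + b p.1 * w p) =
      fun p => a p.1 * pderiv k u p + b p.1 * pderiv k w p := by
  funext ⟨τ, x⟩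
  have hc : ContDiff ℝ ∞ fun p : ℝ × Space d => a p.1 * u p + b p.1 * w p :=
    ((ha.comp contDiff_fst).mul hu).add ((hb.comp contDiff_fst).mul hw)
  rw [← fderiv_slice hc]
  have h := ((hasFDerivAt_slice hu τ x).const_mul (a τ)).add
    ((hasFDerivAt_slice hw τ x).const_mul (b τ))
  erw [h.fderiv]
  simp [pderiv]

theorem contDiff_det {n : ℕ} {P : Type*} [NormedAddCommGroup P] [NormedSpace ℝ P]
    {B : P → Matrix (Fin n) (Fin n) ℂ} (hB : ∀ i j, ContDiff ℝ ∞ fun p => B p i j) :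
    ContDiff ℝ ∞ fun p => (B p).det := by
  simp_rw [Matrix.det_apply]
  exact ContDiff.sum fun σ _ => (contDiff_prod fun i _ => hB (σ i) i).const_smul _

theorem contDiff_adjugate {n : ℕ} {P : Type*} [NormedAddCommGroup P] [NormedSpace ℝ P]
    {B : P → Matrix (Fin n) (Fin n) ℂ} (hB : ∀ i j, ContDiff ℝ ∞ fun p => B p i j)
    (i j : Fin n) : ContDiff ℝ ∞ fun p => (B p).adjugate i j := by
  simp_rw [Matrix.adjugate_apply]
  refine contDiff_det fun k l => ?_
  by_cases h : k = j
  · subst h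
    simp only [Matrix.updateRow_self]
    exact contDiff_const
  · simp only [Matrix.updateRow_ne h]
    exact hB k l

/-- A smooth function without zeros on a compact set coincides there with the inverse of a smooth
function. -/
theorem exists_smooth_inverse {P : Type*} [NormedAddCommGroup P] [NormedSpace ℝ P]
    [FiniteDimensional ℝ P] {D : P → ℂ} (hD : ContDiff ℝ ∞ D) {K : Set P} (hK : IsCompact K)
    (hDK : ∀ p ∈ K, D p ≠ 0) :
    ∃ κ : P → ℂ, ContDiff ℝ ∞ κ ∧ ∀ p ∈ K, κ p * D p = 1 := by
  obtain ⟨f, hf0, hf1, -⟩ := exists_contMDiffMap_zero_one_of_isClosed (modelWithCornersSelf ℝ P)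
    (n := ⊤) (s := {p | D p = 0}) (t := K) (isClosed_eq hD.continuous continuous_const)
    hK.isClosed (Set.disjoint_left.2 fun p hp hpK => hDK p hpK hp)
  have hf : ContDiff ℝ ∞ (f : P → ℝ) := f.contMDiff.contDiff
  have hDc : ContDiff ℝ ∞ fun p => starRingEnd ℂ (D p) := Complex.conjCLE.contDiff.comp hD
  -- The denominator is positive, since `f = 0` where `D = 0`; it equals `‖D‖²` where `f = 1`.
  have hden (p : P) : starRingEnd ℂ (D p) * D p + (1 - (f p : ℂ)) ^ 2 =
      ((Complex.normSq (D p) + (1 - f p) ^ 2 : ℝ) : ℂ) := by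
    rw [mul_comm, Complex.mul_conj]; push_cast; ring
  have hne (p : P) : starRingEnd ℂ (D p) * D p + (1 - (f p : ℂ)) ^ 2 ≠ 0 := by
    rw [hden, Complex.ofReal_ne_zero]
    by_cases h : D p = 0
    · have : f p = 0 := hf0 h
      simp [h, this]
    · have := Complex.normSq_pos.2 h
      positivity
  refine ⟨fun p => starRingEnd ℂ (D p) * (starRingEnd ℂ (D p) * D p + (1 - (f p : ℂ)) ^ 2)⁻¹,
    hDc.mul (ContDiff.inv ((hDc.mul hD).add
      ((contDiff_const.sub (Complex.ofRealCLM.contDiff.comp hf)).pow 2)) hne), fun p hp => ?_⟩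
  have : f p = 1 := hf1 hp
  have h := hne p
  beta_reduce
  rw [this] at h ⊢
  simp only [Complex.ofReal_one, sub_self, ne_eq, OfNat.ofNat_ne_zero, not_false_eq_true, zero_pow,
    add_zero] at h ⊢
  rw [mul_right_comm, mul_inv_cancel₀ h]

/-- The quadratic form `‖x‖²/2`. -/
noncomputable def halfSq (x : Space d) : ℂ := ∑ j, (x j : ℂ) * ((1 / 2 : ℂ) * (x j : ℂ))

theorem halfSq_eq (x : Space d) : halfSq x = ((‖x‖ ^ 2 / 2 : ℝ) : ℂ) := by
  rw [halfSq, EuclideanSpace.real_norm_sq_eq, Finset.sum_div]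
  push_cast
  exact Finset.sum_congr rfl fun j _ => by ring

theorem halfSq_contDiff : ContDiff ℝ ∞ (fun p : ℝ × Space d => halfSq p.2) :=
  ContDiff.sum fun j _ => (contDiff_coord j).mul (contDiff_const.mul (contDiff_coord j))

theorem pderiv_const_mul {u : ℝ × Space d → ℂ} (hu : ContDiff ℝ ∞ u) (c : ℂ) (k : Fin d)
    (p : ℝ × Space d) : pderiv k (fun p => c * u p) p = c * pderiv k u p := by
  have h := ((hu.differentiable (by simp)) p).hasFDerivAt.const_mul c
  rw [pderiv, h.fderiv]
  simp [pderiv]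

theorem pderiv_halfSq (k : Fin d) :
    pderiv k (fun p : ℝ × Space d => halfSq p.2) = fun p => (p.2 k : ℂ) := by
  funext p
  have h := pderiv_sum_coord_mul (v := fun j p => (1 / 2 : ℂ) * ((p.2 j : ℝ) : ℂ))
    (fun j => contDiff_const.mul (contDiff_coord (d := d) j)) k p
  refine h.trans ?_
  simp_rw [pderiv_const_mul (contDiff_coord _), pderiv_coord]
  simp
  ring

/-- A smooth function vanishing to second order at the origin has a symmetric Hessian matrix there,
and if its real part is nonnegative near the origin then the real part of the Hessian matrix is
positive semidefinite. -/
theorem hessianMatrix_symm_and_nonneg {ψ : Space d → ℂ} (hψ : ContDiff ℝ ∞ ψ) (hψ0 : ψ 0 = 0)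
    (hψ1 : ∀ k, partialDeriv k ψ 0 = 0) (hre : ∀ᶠ x in 𝓝 (0 : Space d), 0 ≤ (ψ x).re) :
    (∀ i j, hessianMatrix ψ 0 i j = hessianMatrix ψ 0 j i) ∧
      ∀ x : Fin d → ℝ, 0 ≤ ∑ i, ∑ j, x i * x j * (hessianMatrix ψ 0 i j).re := by
  obtain ⟨v, hv, hψv⟩ := exists_hadamard (contDiff_comp_snd hψ)
  have hv_eq : (fun p : ℝ × Space d => ψ p.2) = fun p => ∑ j, (p.2 j : ℂ) * v j p := by
    funext ⟨τ, x⟩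
    have := hψv τ x
    simpa [hψ0] using this
  have hv0 (j : Fin d) (τ : ℝ) : v j (τ, 0) = 0 := by
    have h := pderiv_sum_coord_mul hv j (τ, 0)
    rw [← hv_eq, pderiv_comp_snd hψ] at h
    simpa [hψ1] using h.symm
  have hhess (i j : Fin d) : hessianMatrix ψ 0 i j =
      pderiv i (v j) (0, 0) + pderiv j (v i) (0, 0) := by
    rw [← pderiv_pderiv_comp_snd hψ i j 0, hv_eq, pderiv_pderiv_sum_coord_mul hv]
  refine ⟨fun i j => by rw [hhess, hhess, add_comm], fun x => ?_⟩
  choose w hw hvw using fun j => exists_hadamard (hv j)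
  have hvw' (j k : Fin d) : pderiv k (v j) (0, 0) = w j k (0, 0) := by
    have h := pderiv_sum_coord_mul (hw j) k ((0 : ℝ), (0 : Space d))
    rw [← fderiv_slice (ContDiff.sum fun i _ => (contDiff_coord i).mul (hw j i))] at h
    rw [← fderiv_slice (hv j)]
    have : (fun y => v j ((0 : ℝ), y)) = fun y : Space d => ∑ i, (y i : ℂ) * w j i (0, y) := by
      funext y
      rw [hvw j 0 y, hv0, zero_add]
    rw [this, h]
    simp
  -- Along the ray through `x`, `ψ(s x)` is `s²` times a function tending to half the Hessian form.
  let X : Space d := WithLp.toLp 2 x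
  have hX (s : ℝ) : ψ (s • X) = s ^ 2 * ∑ j, ∑ k, (x j : ℂ) * x k * w j k (0, s • X) := by
    have h1 := congrFun hv_eq ((0 : ℝ), s • X)
    simp only at h1
    rw [h1, Finset.mul_sum]
    refine Finset.sum_congr rfl fun j _ => ?_
    rw [hvw j 0, hv0, zero_add, Finset.mul_sum, Finset.mul_sum]
    refine Finset.sum_congr rfl fun k _ => ?_
    simp [X]
    ring
  have hcont : Continuous fun s : ℝ =>
      (∑ j, ∑ k, (x j : ℂ) * x k * w j k (0, s • X)).re := by
    refine Complex.continuous_re.comp (continuous_finsetSum _ fun j _ =>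
      continuous_finsetSum _ fun k _ => continuous_const.mul ((hw j k).continuous.comp ?_))
    fun_prop
  have hlim : 0 ≤ (∑ j, ∑ k, (x j : ℂ) * x k * w j k (0, (0 : ℝ) • X)).re := by
    refine ge_of_tendsto ((hcont.tendsto 0).mono_left nhdsWithin_le_nhds :
      Tendsto _ (𝓝[≠] (0 : ℝ)) _) ?_
    have hs : Tendsto (fun s : ℝ => s • X) (𝓝[≠] 0) (𝓝 0) := by
      have : Continuous fun s : ℝ => s • X := by fun_prop
      simpa using (this.tendsto 0).mono_left nhdsWithin_le_nhds
    filter_upwards [hs.eventually hre, self_mem_nhdsWithin] with s h1 h2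
    rw [hX, ← Complex.ofReal_pow, Complex.re_ofReal_mul] at h1
    exact nonneg_of_mul_nonneg_right h1 (by have : s ≠ 0 := h2; positivity)
  have hfin : ∑ i, ∑ j, x i * x j * (hessianMatrix ψ 0 i j).re =
      2 * (∑ j, ∑ k, (x j : ℂ) * x k * w j k (0, (0 : ℝ) • X)).re := by
    have h1 : ∑ i, ∑ j, x i * x j * (w j i (0, 0)).re =
        ∑ i, ∑ j, x i * x j * (w i j (0, 0)).re := by
      rw [Finset.sum_comm]
      exact Finset.sum_congr rfl fun i _ => Finset.sum_congr rfl fun j _ => by ring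
    simp_rw [hhess, hvw', Complex.add_re, mul_add, Finset.sum_add_distrib, h1, zero_smul,
      Complex.re_sum, ← Complex.ofReal_mul, Complex.re_ofReal_mul]
    ring
  rw [hfin]
  linarith

end Construction

/-! ### The linear deformation to the quadratic phase -/

section Deformation

variable {d : ℕ}

/-- The linear deformation `(1 - τ) ‖x‖²/2 + τ ψ(x)` of the standard quadratic phase into `ψ`. -/
noncomputable def linPhase (ψ : Space d → ℂ) (p : ℝ × Space d) : ℂ :=
  (1 - (p.1 : ℂ)) * halfSq p.2 + (p.1 : ℂ) * ψ p.2

theorem ofReal_contDiff : ContDiff ℝ ∞ (fun τ : ℝ => (τ : ℂ)) := Complex.ofRealCLM.contDiff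

theorem linPhase_contDiff {ψ : Space d → ℂ} (hψ : ContDiff ℝ ∞ ψ) : ContDiff ℝ ∞ (linPhase ψ) :=
  (((contDiff_const.sub ofReal_contDiff).comp contDiff_fst).mul halfSq_contDiff).add
    ((ofReal_contDiff.comp contDiff_fst).mul (contDiff_comp_snd hψ))

theorem pderiv_linPhase {ψ : Space d → ℂ} (hψ : ContDiff ℝ ∞ ψ) (k : Fin d) :
    pderiv k (linPhase ψ) = fun p =>
      (1 - (p.1 : ℂ)) * (p.2 k : ℂ) + (p.1 : ℂ) * partialDeriv k ψ p.2 := by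
  have h := pderiv_linearCombination (a := fun τ => 1 - (τ : ℂ)) (b := fun τ => (τ : ℂ))
    (halfSq_contDiff (d := d)) (contDiff_comp_snd hψ) (contDiff_const.sub ofReal_contDiff)
    ofReal_contDiff k
  rw [pderiv_halfSq, pderiv_comp_snd hψ] at h
  exact h

theorem pderiv_pderiv_linPhase {ψ : Space d → ℂ} (hψ : ContDiff ℝ ∞ ψ) (j k : Fin d) (τ : ℝ) :
    pderiv j (pderiv k (linPhase ψ)) (τ, 0) = segMatrix (hessianMatrix ψ 0) τ k j +
      (τ : ℂ) * (hessianMatrix ψ 0 j k - hessianMatrix ψ 0 k j) := by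
  rw [pderiv_linPhase hψ]
  have h := pderiv_linearCombination (a := fun τ => 1 - (τ : ℂ)) (b := fun τ => (τ : ℂ))
    (contDiff_coord (d := d) k) (contDiff_comp_snd (partialDeriv_contDiff hψ k))
    (contDiff_const.sub ofReal_contDiff) ofReal_contDiff j
  refine (congrFun h (τ, 0)).trans ?_
  beta_reduce
  rw [pderiv_coord, pderiv_comp_snd (partialDeriv_contDiff hψ k)]
  simp only [segMatrix, hessianMatrix, Matrix.add_apply, Matrix.smul_apply, Matrix.of_apply,
    Matrix.one_apply, smul_eq_mul]
  ring

theorem re_linPhase (ψ : Space d → ℂ) (τ : ℝ) (x : Space d) :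
    (linPhase ψ (τ, x)).re = (1 - τ) * (‖x‖ ^ 2 / 2) + τ * (ψ x).re := by
  rw [linPhase, halfSq_eq, Complex.add_re, ← Complex.ofReal_one, ← Complex.ofReal_sub,
    Complex.re_ofReal_mul, Complex.re_ofReal_mul, Complex.ofReal_re]

/-- The linear deformation is a phase family on a sufficiently small ball. -/
theorem exists_phaseFamily {ψ : Space d → ℂ} (hψ : ContDiff ℝ ∞ ψ)
    (hψ1 : ∀ k, partialDeriv k ψ 0 = 0)
    (hsymm : ∀ i j, hessianMatrix ψ 0 i j = hessianMatrix ψ 0 j i)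
    (hdet : ∀ τ ∈ Set.Icc (0 : ℝ) 1, (segMatrix (hessianMatrix ψ 0) τ).det ≠ 0)
    {ρ : ℝ} (hρ : 0 < ρ) (hnn : ∀ x, ‖x‖ ≤ ρ → 0 ≤ (ψ x).re)
    (hpos : ∀ x, ‖x‖ ≤ ρ → x ≠ 0 → 0 < (ψ x).re) :
    ∃ F : PhaseFamily d, F.phase = linPhase ψ ∧ 0 < F.r ∧ F.R ≤ ρ ∧
      ∀ τ ∈ Set.Icc (0 : ℝ) 1, ∀ j k,
        F.coeff j k (τ, 0) = (segMatrix (hessianMatrix ψ 0) τ)⁻¹ j k := by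
  have hΦ := linPhase_contDiff hψ
  have hgrad0 (k : Fin d) (τ : ℝ) : pderiv k (linPhase ψ) (τ, 0) = 0 := by
    rw [pderiv_linPhase hψ]; simp [hψ1]
  choose b hb hgrad using fun k => exists_hadamard (pderiv_contDiff hΦ k)
  simp_rw [hgrad0, zero_add] at hgrad
  let B : ℝ × Space d → Matrix (Fin d) (Fin d) ℂ := fun p => Matrix.of fun k j => b k j p
  have hB (i j : Fin d) : ContDiff ℝ ∞ fun p => B p i j := hb i j
  have hB0 (τ : ℝ) : B (τ, 0) = segMatrix (hessianMatrix ψ 0) τ := by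
    ext k j
    have h := pderiv_pderiv_linPhase hψ j k τ
    rw [hsymm j k, sub_self, mul_zero, add_zero] at h
    rw [← h, show pderiv k (linPhase ψ) = fun p => ∑ j, (p.2 j : ℂ) * b k j p from
      funext fun p => hgrad k p.1 p.2, pderiv_sum_coord_mul (hb k)]
    simp [B]
  have hD : ContDiff ℝ ∞ fun p => (B p).det := contDiff_det hB
  -- By compactness of `[0, 1]`, the matrices stay invertible on a ball independent of `τ`.
  obtain ⟨U, V, -, hV, hIU, h0V, hUV⟩ := generalized_tube_lemma
    (isCompact_Icc (a := (0 : ℝ)) (b := 1))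
    (isCompact_singleton (x := (0 : Space d))) (n := {p | (B p).det ≠ 0})
    (isOpen_ne_fun hD.continuous continuous_const) (by
      rintro ⟨τ, x⟩ ⟨hτ, rfl⟩
      simpa [hB0] using hdet τ hτ)
  obtain ⟨δ, hδ, hδV⟩ := Metric.isOpen_iff.1 hV 0 (h0V rfl)
  let R := min ρ (δ / 2)
  have hR : 0 < R := lt_min hρ (by linarith)
  have hRρ : R ≤ ρ := min_le_left _ _
  have hRδ : R < δ := (min_le_right _ _).trans_lt (by linarith)
  obtain ⟨κ, hκ, hκD⟩ := exists_smooth_inverse hD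
    (isCompact_Icc.prod (isCompact_closedBall (0 : Space d) R))
    (K := Set.Icc (0 : ℝ) 1 ×ˢ Metric.closedBall (0 : Space d) R) fun p hp =>
      hUV ⟨hIU hp.1, hδV (Metric.closedBall_subset_ball hRδ hp.2)⟩
  have hposΦ : ∀ τ ∈ Set.Icc (0 : ℝ) 1, ∀ x, ‖x‖ ≤ R → x ≠ 0 →
      0 < (linPhase ψ (τ, x)).re := fun τ hτ x hx hx0 => by
    rw [re_linPhase]
    have h1 := hpos x (hx.trans hRρ) hx0
    have h2 : 0 < ‖x‖ := norm_pos_iff.2 hx0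
    rcases eq_or_lt_of_le hτ.1 with h | h
    · rw [← h]
      have : 0 < ‖x‖ ^ 2 / 2 := by positivity
      linarith
    · have h3 : 0 ≤ (1 - τ) * (‖x‖ ^ 2 / 2) := mul_nonneg (by linarith [hτ.2]) (by positivity)
      have := mul_pos h h1
      linarith
  obtain ⟨ε, hε, hεΦ⟩ := (isCompact_Icc.prod ((isCompact_closedBall (0 : Space d) R).diff
    (Metric.isOpen_ball (x := (0 : Space d)) (ε := R / 2)))).exists_forall_le'
    (s := Set.Icc (0 : ℝ) 1 ×ˢ (Metric.closedBall (0 : Space d) R \ Metric.ball 0 (R / 2)))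
    (f := fun p => (linPhase ψ p).re) (a := 0)
    (Complex.continuous_re.comp hΦ.continuous).continuousOn (by
      rintro ⟨τ, x⟩ ⟨hτ, hx, hx'⟩
      refine hposΦ τ hτ x (by simpa using hx) ?_
      rintro rfl
      exact hx' (by simpa using hR))
  let χ : ContDiffBump (0 : Space d) := ⟨R / 2, R, by linarith, by linarith⟩
  refine ⟨{ phase := linPhase ψ
            cutoff := fun x => (χ x : ℂ)
            coeff := fun j k p => κ p * (B p).adjugate j k
            r := R / 2
            R := R
            ε := ε
            phase_contDiff := hΦ
            cutoff_contDiff := Complex.ofRealCLM.contDiff.comp χ.contDiff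
            coeff_contDiff := fun j k => hκ.mul (contDiff_adjugate hB j k)
            cutoff_eq_zero := fun x hx => ?_
            cutoff_eq_one := fun x hx => ?_
            ε_pos := hε
            re_nonneg := fun τ hτ x hx => ?_
            le_re := fun τ hτ x hx hx' => ?_
            coord_eq := fun τ hτ x hx j => ?_ }, rfl, by simpa using hR, hRρ, fun τ hτ j k => ?_⟩
  · rw [χ.zero_of_le_dist (by simpa using hx.le), Complex.ofReal_zero]
  · rw [χ.one_of_mem_closedBall (by simpa using hx), Complex.ofReal_one]
  · rw [re_linPhase]
    have h1 := mul_nonneg hτ.1 (hnn x (hx.trans hRρ))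
    have h2 : 0 ≤ (1 - τ) * (‖x‖ ^ 2 / 2) := mul_nonneg (by linarith [hτ.2]) (by positivity)
    linarith
  · exact hεΦ (τ, x) ⟨hτ, by simpa using hx', by simpa using hx⟩
  · have h1 := hκD (τ, x) ⟨hτ, by simpa using hx⟩
    have h2 : ∀ k, pderiv k (linPhase ψ) (τ, x) =
        (B (τ, x)).mulVec (fun j => (x j : ℂ)) k := fun k => by
      rw [hgrad k τ x]
      exact Finset.sum_congr rfl fun j _ => mul_comm _ _
    simp_rw [h2, mul_assoc, ← Finset.mul_sum]
    change _ = κ (τ, x) * ((B (τ, x)).adjugate.mulVec ((B (τ, x)).mulVec fun j => (x j : ℂ))) j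
    rw [Matrix.mulVec_mulVec, Matrix.adjugate_mul, Matrix.smul_mulVec, Matrix.one_mulVec,
      Pi.smul_apply, smul_eq_mul, ← mul_assoc, h1, one_mul]
  · have h1 := hκD (τ, 0) ⟨hτ, by simpa using hR.le⟩
    have h2 : κ (τ, 0) = ((B (τ, 0)).det)⁻¹ := eq_inv_of_mul_eq_one_left h1
    change κ (τ, 0) * (B (τ, 0)).adjugate j k = _
    rw [h2, hB0, Matrix.inv_def, Matrix.smul_apply, Ring.inverse_eq_inv', smul_eq_mul]

end Deformation

/-! ### Localization and the Gaussian integral -/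

section Localization

variable {d : ℕ}

theorem isBigO_exp_neg {δ : ℝ} (hδ : 0 < δ) (N : ℕ) :
    (fun t : ℝ => Real.exp (-(δ * t))) =O[atTop] (fun t : ℝ => (t ^ N)⁻¹) := by
  refine Asymptotics.IsBigO.of_bound (N.factorial / δ ^ N) ?_
  filter_upwards [eventually_gt_atTop 0] with t ht
  rw [Real.norm_of_nonneg (Real.exp_nonneg _), Real.norm_of_nonneg (by positivity)]
  exact PhaseFamily.exp_neg_le hδ ht N

namespace PhaseFamily

variable (F : PhaseFamily d)

theorem exists_norm_cutoff_le : ∃ M, 0 ≤ M ∧ ∀ x, ‖1 - F.cutoff x‖ ≤ M := by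
  have hc := F.cutoff_contDiff.continuous
  obtain ⟨M, hM⟩ := (isCompact_closedBall (0 : Space d) F.R).exists_bound_of_continuousOn
    (f := fun x => 1 - F.cutoff x) (by fun_prop)
  refine ⟨max M 1, by positivity, fun x => ?_⟩
  by_cases hx : x ∈ Metric.closedBall (0 : Space d) F.R
  · exact (hM x hx).trans (le_max_left _ _)
  · simp only [Metric.mem_closedBall, dist_zero_right, not_le] at hx
    simp [F.cutoff_eq_zero x hx]

/-- For the phase `‖x‖²/2`, the integral is a Gaussian integral up to an exponentially small
error. -/
theorem osc_zero_sub_gaussian_isBigO (hr : 0 < F.r)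
    (hF : ∀ x, F.phase (0, x) = ((‖x‖ ^ 2 / 2 : ℝ) : ℂ)) :
    (fun t => F.osc (fun _ => 1) 0 t - (((2 * Real.pi / t) ^ ((d : ℝ) / 2) : ℝ) : ℂ)) =O[atTop]
      (fun t => Real.exp (-(F.r ^ 2 / 2 * t))) := by
  obtain ⟨M, hM0, hM⟩ := F.exists_norm_cutoff_le
  have hgauss (t : ℝ) (ht : 0 < t) : Integrable fun x : Space d =>
      Real.exp (-(t / 2) * ‖x‖ ^ 2) := by
    have h := (GaussianFourier.integrable_cexp_neg_mul_sq_norm_add (V := Space d)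
      (b := ((t / 2 : ℝ) : ℂ)) (by rw [Complex.ofReal_re]; positivity) 0 0).norm
    refine h.congr (Eventually.of_forall fun x => ?_)
    beta_reduce
    rw [Complex.norm_exp]
    congr 1
    simp [← Complex.ofReal_pow]
  refine Asymptotics.IsBigO.of_bound
    (M * Real.exp (F.r ^ 2 / 2) * ∫ x : Space d, Real.exp (-(1 / 2) * ‖x‖ ^ 2)) ?_
  filter_upwards [eventually_ge_atTop 1] with t ht
  have ht0 : 0 < t := by linarith
  have hexp (x : Space d) : Complex.exp (-(t : ℂ) * F.phase (0, x)) =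
      ((Real.exp (-(t / 2) * ‖x‖ ^ 2) : ℝ) : ℂ) := by
    rw [hF, Complex.ofReal_exp]; push_cast; congr 1; ring
  have h1 : (((2 * Real.pi / t) ^ ((d : ℝ) / 2) : ℝ) : ℂ) =
      ∫ x : Space d, ((Real.exp (-(t / 2) * ‖x‖ ^ 2) : ℝ) : ℂ) := by
    rw [integral_complex_ofReal, GaussianFourier.integral_rexp_neg_mul_sq_norm (by positivity)]
    congr 2
    · field_simp
    · simp
  have h2 := F.integrable_osc (u := fun _ => 1) continuous_const 0 t
  have h3 : Integrable fun x : Space d => ((Real.exp (-(t / 2) * ‖x‖ ^ 2) : ℝ) : ℂ) :=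
    (hgauss t ht0).ofReal
  rw [h1, osc, ← integral_sub h2 h3, Real.norm_of_nonneg (Real.exp_nonneg _),
    mul_right_comm, ← integral_const_mul]
  refine norm_integral_le_of_norm_le ((hgauss 1 one_pos).const_mul _)
    (Eventually.of_forall fun x => ?_)
  rw [hexp, mul_one, ← sub_one_mul, norm_mul, norm_sub_rev, Complex.norm_real,
    Real.norm_of_nonneg (Real.exp_nonneg _)]
  by_cases hx : ‖x‖ ≤ F.r
  · rw [F.cutoff_eq_one x hx]
    simp only [sub_self, norm_zero, zero_mul]
    positivity
  · rw [mul_assoc, mul_assoc, ← Real.exp_add, ← Real.exp_add]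
    gcongr
    · exact hM x
    · have h4 : F.r ^ 2 ≤ ‖x‖ ^ 2 := by
        rw [not_le] at hx
        gcongr
      nlinarith [mul_le_mul_of_nonneg_left h4 (by linarith : 0 ≤ t - 1)]

/-- Away from the origin the phase has positive real part, so that the phase integral localizes,
up to an exponentially small error. -/
theorem exists_phaseIntegral_sub_isBigO (hr : 0 < F.r) {𝒩 : Set (Space d)} (h𝒩 : IsCompact 𝒩)
    (hR𝒩 : ∀ x, ‖x‖ ≤ F.R → x ∈ 𝒩) {A φ : Space d → ℂ} (hA : ContinuousOn A 𝒩)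
    (hφ : ContinuousOn φ 𝒩) (hpos : ∀ x ∈ 𝒩, x ≠ 0 → 0 < (φ x).re) (hφ0 : (φ 0).re = 0)
    {u : ℝ × Space d → ℂ} (huA : ∀ x, ‖x‖ ≤ F.R → u (1, x) = A x)
    (hphase : ∀ x, ‖x‖ ≤ F.R → F.phase (1, x) = φ x - φ 0) :
    ∃ δ, 0 < δ ∧ (fun t : ℝ => Complex.exp (t * φ 0) * phaseIntegral 𝒩 A φ t -
      F.osc u 1 t) =O[atTop] (fun t => Real.exp (-(δ * t))) := by
  have hχ := F.cutoff_contDiff.continuous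
  obtain ⟨δ, hδ, hδφ⟩ := (h𝒩.diff (Metric.isOpen_ball (x := (0 : Space d))
    (ε := F.r))).exists_forall_le' (f := fun x => (φ x).re) (a := 0)
    (Complex.continuous_re.comp_continuousOn (hφ.mono Set.sdiff_subset)) (by
      rintro x ⟨hx, hx'⟩
      refine hpos x hx ?_
      rintro rfl
      exact hx' (by simpa using hr))
  have hB : ContinuousOn (fun x => (1 - F.cutoff x) * A x) 𝒩 := by fun_prop
  obtain ⟨M, hM⟩ := h𝒩.exists_bound_of_continuousOn hB
  refine ⟨δ, hδ, Asymptotics.IsBigO.of_bound (max M 0 * volume.real 𝒩) ?_⟩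
  filter_upwards [eventually_ge_atTop 0] with t ht
  have h1 : F.osc u 1 t = ∫ x in 𝒩, F.cutoff x * A x * Complex.exp (-(t : ℂ) * (φ x - φ 0)) := by
    rw [osc, ← setIntegral_eq_integral_of_forall_compl_eq_zero (s := 𝒩)]
    · refine setIntegral_congr_fun h𝒩.measurableSet fun x _ => ?_
      rcases lt_or_ge F.R ‖x‖ with hx | hx
      · simp [F.cutoff_eq_zero x hx]
      · simp only [huA x hx, hphase x hx]
    · intro x hx
      have : F.R < ‖x‖ := lt_of_not_ge fun h => hx (hR𝒩 x h)
      simp [F.cutoff_eq_zero x this]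
  have h2 : Complex.exp (t * φ 0) * phaseIntegral 𝒩 A φ t =
      ∫ x in 𝒩, A x * Complex.exp (-(t : ℂ) * (φ x - φ 0)) := by
    rw [phaseIntegral, ← integral_const_mul]
    congr 1 with x
    rw [mul_left_comm, ← Complex.exp_add]
    congr 2; ring
  rw [h1, h2, ← integral_sub
    (ContinuousOn.integrableOn_compact h𝒩 (by fun_prop))
    (ContinuousOn.integrableOn_compact h𝒩 (by fun_prop)),
    Real.norm_of_nonneg (Real.exp_nonneg _)]
  refine (norm_setIntegral_le_of_norm_le_const (C := max M 0 * Real.exp (-(δ * t)))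
    h𝒩.measure_lt_top fun x hx => ?_).trans (le_of_eq (by ring))
  rw [← sub_mul, ← one_sub_mul, norm_mul]
  by_cases hxr : ‖x‖ < F.r
  · rw [F.cutoff_eq_one x hxr.le]
    simp only [sub_self, zero_mul, norm_zero]
    positivity
  · gcongr
    · exact (hM x hx).trans (le_max_left _ _)
    · rw [Complex.norm_exp]
      have h3 := mul_le_mul_of_nonneg_right (hδφ x ⟨hx, by simpa using hxr⟩) ht
      simp only [Complex.mul_re, Complex.neg_re, Complex.ofReal_re, Complex.neg_im,
        Complex.ofReal_im, Complex.sub_re, hφ0]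
      gcongr
      linarith

end PhaseFamily

theorem contDiff_bump_mul {f : Space d → ℂ} {s : Set (Space d)} (hf : AnalyticOn ℝ f s)
    (η : ContDiffBump (0 : Space d)) (hη : Metric.closedBall 0 η.rOut ⊆ interior s) :
    ContDiff ℝ ∞ fun x => (η x : ℂ) * f x := by
  rw [contDiff_iff_contDiffAt]
  intro x
  by_cases hx : x ∈ tsupport η
  · have h1 := isOpen_interior.analyticOn_iff_analyticOnNhd.1 (hf.mono interior_subset)
    rw [η.tsupport_eq] at hx
    exact (Complex.ofRealCLM.contDiff.comp η.contDiff).contDiffAt.mul (h1 x (hη hx)).contDiffAt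
  · have h1 : (fun x => (η x : ℂ) * f x) =ᶠ[𝓝 x] fun _ => 0 := by
      filter_upwards [notMem_tsupport_iff_eventuallyEq.1 hx] with y hy
      rw [hy]; simp
    exact contDiffAt_const.congr_of_eventuallyEq h1

theorem partialDeriv_congr {f g : Space d → ℂ} {x : Space d} (h : f =ᶠ[𝓝 x] g) (k : Fin d) :
    partialDeriv k f =ᶠ[𝓝 x] partialDeriv k g := by
  filter_upwards [h.fderiv (𝕜 := ℝ)] with y hy
  rw [partialDeriv, partialDeriv, hy]

theorem hessianMatrix_congr {f g : Space d → ℂ} {x : Space d} (h : f =ᶠ[𝓝 x] g) :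
    hessianMatrix f x = hessianMatrix g x := by
  ext i j
  exact (partialDeriv_congr (partialDeriv_congr h j) i).eq_of_nhds

theorem partialDeriv_sub_const (f : Space d → ℂ) (c : ℂ) (k : Fin d) :
    partialDeriv k (fun x => f x - c) = partialDeriv k f := by
  funext x
  simp only [partialDeriv, fderiv_sub_const]

theorem hessianMatrix_sub_const (f : Space d → ℂ) (c : ℂ) (x : Space d) :
    hessianMatrix (fun x => f x - c) x = hessianMatrix f x := by
  ext i j
  simp only [hessianMatrix, partialDeriv_sub_const]

end Localization

/-! ### The asymptotic expansion of the phase integral -/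

section Combination

open Asymptotics Polynomial

/-- The polynomial `∑_{l < M} a_l X^l`. -/
noncomputable def truncPoly (a : ℕ → ℂ) (M : ℕ) : ℂ[X] := ∑ l ∈ Finset.range M, C (a l) * X ^ l

theorem truncPoly_eval (a : ℕ → ℂ) (M : ℕ) (t : ℝ) :
    (truncPoly a M).eval ((t : ℂ)⁻¹) = ∑ l ∈ Finset.range M, a l * ((t : ℂ) ^ l)⁻¹ := by
  simp [truncPoly, eval_finsetSum]

theorem truncPoly_coeff_zero (a : ℕ → ℂ) (M : ℕ) : (truncPoly a (M + 1)).coeff 0 = a 0 := by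
  rw [coeff_zero_eq_eval_zero]
  simp [truncPoly, eval_finsetSum, Finset.sum_range_succ']

theorem isBigO_of_forall_norm_le {f : ℝ → ℂ} {C : ℝ} {M : ℕ}
    (h : ∀ t : ℝ, 1 ≤ t → ‖f t‖ ≤ C * (t ^ M)⁻¹) : f =O[atTop] (fun t : ℝ => (t ^ M)⁻¹) := by
  refine IsBigO.of_bound C ?_
  filter_upwards [eventually_ge_atTop 1] with t ht
  rw [Real.norm_of_nonneg (by positivity)]
  exact h t ht

/-- The comparison of an integral `I` with an amplitude-free integral `j₁`, then by transport with
a Gaussian integral, yields polynomial approximations in `1/t` of `t^(d/2) I(t)`. -/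
theorem exists_poly_approx {d N : ℕ} {I j₁ j₀ : ℝ → ℂ} {b p : ℂ[X]} {M : ℕ} (hM : N + d ≤ M)
    (hI : (fun t : ℝ => I t - b.eval ((t : ℂ)⁻¹) * j₁ t) =O[atTop] (fun t : ℝ => (t ^ M)⁻¹))
    (hj : (fun t : ℝ => Complex.exp (p.eval ((t : ℂ)⁻¹)) * j₁ t - j₀ t) =O[atTop]
      (fun t : ℝ => (t ^ M)⁻¹))
    (hG : (fun t : ℝ => j₀ t - (((2 * Real.pi / t) ^ ((d : ℝ) / 2) : ℝ) : ℂ)) =O[atTop]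
      (fun t : ℝ => (t ^ M)⁻¹)) :
    ∃ q : ℂ[X], q.coeff 0 =
        b.coeff 0 * (((2 * Real.pi) ^ ((d : ℝ) / 2) : ℝ) : ℂ) * Complex.exp (-p.coeff 0) ∧
      (fun t : ℝ => ((t ^ ((d : ℝ) / 2) : ℝ) : ℂ) * I t - q.eval ((t : ℂ)⁻¹)) =O[atTop]
        (fun t : ℝ => (t ^ N)⁻¹) := by
  obtain ⟨Q, hQ0, hQ⟩ := exists_exp_eval_sub_isBigO (-p) N
  set κ : ℂ := (((2 * Real.pi) ^ ((d : ℝ) / 2) : ℝ) : ℂ) with hκ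
  refine ⟨b * C κ * Q, by simp [mul_coeff_zero, hQ0], ?_⟩
  have hexp : (fun t : ℝ => Complex.exp ((-p).eval ((t : ℂ)⁻¹))) =O[atTop] fun _ => (1 : ℝ) :=
    ((Complex.continuous_exp.tendsto _).comp (tendsto_eval_inv (-p))).isBigO_one ℝ
  have h1 := ((isBigO_eval_inv b).mul hexp).mul (hj.add hG)
  simp only [one_mul] at h1
  have h2 := hI.add h1
  have hpow : (fun t : ℝ => ((t ^ ((d : ℝ) / 2) : ℝ) : ℂ)) =O[atTop] fun t : ℝ => t ^ d := by
    refine IsBigO.of_bound 1 ?_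
    filter_upwards [eventually_ge_atTop 1] with t ht
    have ht0 : 0 ≤ t := by linarith
    rw [Complex.norm_real, Real.norm_of_nonneg (by positivity), Real.norm_of_nonneg (by positivity),
      one_mul, ← Real.rpow_natCast]
    exact Real.rpow_le_rpow_of_exponent_le ht (by have : (0 : ℝ) ≤ d := d.cast_nonneg; linarith)
  have h3 : (fun t : ℝ => t ^ d * (t ^ M)⁻¹) =O[atTop] (fun t : ℝ => (t ^ N)⁻¹) := by
    refine (isBigO_inv_pow_of_le (show N ≤ M - d by omega)).congr' ?_ EventuallyEq.rfl
    filter_upwards [eventually_gt_atTop 0] with t ht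
    rw [show M = (M - d) + d by omega, pow_add, Nat.add_sub_cancel]
    field_simp
  have h4 := ((isBigO_eval_inv (b * C κ)).mul hQ)
  simp only [one_mul] at h4
  refine (((hpow.mul h2).trans h3).add h4).congr' ?_ EventuallyEq.rfl
  filter_upwards [eventually_gt_atTop 0] with t ht
  have h5 : ((t ^ ((d : ℝ) / 2) : ℝ) : ℂ) * (((2 * Real.pi / t) ^ ((d : ℝ) / 2) : ℝ) : ℂ) = κ := by
    rw [hκ, ← Complex.ofReal_mul, ← Real.mul_rpow ht.le (by positivity)]
    congr 2
    field_simp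
  have h6 : Complex.exp ((-p).eval ((t : ℂ)⁻¹)) * Complex.exp (p.eval ((t : ℂ)⁻¹)) = 1 := by
    rw [← Complex.exp_add, eval_neg, neg_add_cancel, Complex.exp_zero]
  simp only [eval_mul, eval_C]
  linear_combination (b.eval ((t : ℂ)⁻¹) * ((t ^ ((d : ℝ) / 2) : ℝ) : ℂ) * j₁ t) * h6 -
    (b.eval ((t : ℂ)⁻¹) * Complex.exp ((-p).eval ((t : ℂ)⁻¹))) * h5

end Combination

theorem theorem4p1 (d : ℕ) (𝒩 : Set (EuclideanSpace ℝ (Fin d)))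
    (h𝒩_compact : IsCompact 𝒩) (h𝒩_nhds : 𝒩 ∈ 𝓝 (0 : EuclideanSpace ℝ (Fin d)))
    (A φ : EuclideanSpace ℝ (Fin d) → ℂ)
    (hA : AnalyticOn ℝ A 𝒩) (hφ : AnalyticOn ℝ φ 𝒩)
    (hre_nonneg : ∀ x ∈ 𝒩, 0 ≤ (φ x).re)
    (hre_zero : ∀ x ∈ 𝒩, (φ x).re = 0 ↔ x = 0)
    (hcrit : fderiv ℝ φ 0 = 0)
    (hhess : (hessianMatrix φ 0).det ≠ 0) :
    ∃ c : ℕ → ℂ,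
      c 0 = A 0 * (((2 * Real.pi) ^ ((d : ℝ) / 2) : ℝ) : ℂ) / sqrtDet (hessianMatrix φ 0) ∧
      HasAsymptoticSeries (phaseIntegral 𝒩 A φ) c
        (fun ℓ t => Complex.exp (-(t : ℂ) * φ 0) * ((t ^ (-(d : ℝ) / 2 - (ℓ : ℝ)) : ℝ) : ℂ)) := by
  have h0𝒩 : (0 : Space d) ∈ 𝒩 := mem_of_mem_nhds h𝒩_nhds
  have hφ0 : (φ 0).re = 0 := (hre_zero 0 h0𝒩).2 rfl
  have hpos : ∀ x ∈ 𝒩, x ≠ 0 → 0 < (φ x).re := fun x hx hx0 =>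
    lt_of_le_of_ne (hre_nonneg x hx) fun h => hx0 ((hre_zero x hx).1 h.symm)
  -- Cut-offs `ψ` of `φ - φ 0` and `a` of `A`, smooth on the whole space.
  obtain ⟨ρ, hρ, hρ𝒩⟩ := Metric.nhds_basis_closedBall.mem_iff.1 (interior_mem_nhds.2 h𝒩_nhds)
  let η : ContDiffBump (0 : Space d) := ⟨ρ / 2, ρ, by linarith, by linarith⟩
  have hη1 : ∀ x : Space d, ‖x‖ ≤ ρ / 2 → η x = 1 := fun x hx =>
    η.one_of_mem_closedBall (by simpa using hx)
  have hball : ∀ x : Space d, ‖x‖ ≤ ρ / 2 → x ∈ 𝒩 := fun x hx =>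
    interior_subset (hρ𝒩 (by simpa using hx.trans (by linarith)))
  let ψ : Space d → ℂ := fun x => (η x : ℂ) * (φ x - φ 0)
  let a : Space d → ℂ := fun x => (η x : ℂ) * A x
  have hψ : ContDiff ℝ ∞ ψ := contDiff_bump_mul (hφ.sub analyticOn_const) η hρ𝒩
  have ha : ContDiff ℝ ∞ a := contDiff_bump_mul hA η hρ𝒩
  have hψφ : ∀ x : Space d, ‖x‖ ≤ ρ / 2 → ψ x = φ x - φ 0 := fun x hx => by simp [ψ, hη1 x hx]
  have haA : ∀ x : Space d, ‖x‖ ≤ ρ / 2 → a x = A x := fun x hx => by simp [a, hη1 x hx]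
  have hnear : ∀ᶠ x in 𝓝 (0 : Space d), ‖x‖ ≤ ρ / 2 := by
    filter_upwards [Metric.closedBall_mem_nhds (0 : Space d) (half_pos hρ)] with x hx
    simpa using hx
  have hψe : ψ =ᶠ[𝓝 0] fun x => φ x - φ 0 := hnear.mono hψφ
  have hH : hessianMatrix ψ 0 = hessianMatrix φ 0 := by
    rw [hessianMatrix_congr hψe, hessianMatrix_sub_const]
  have hψ0 : ψ 0 = 0 := by simp [ψ]
  have hψ1 : ∀ k, partialDeriv k ψ 0 = 0 := fun k => by
    rw [(partialDeriv_congr hψe k).eq_of_nhds, partialDeriv_sub_const, partialDeriv, hcrit]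
    simp
  have hψre : ∀ x : Space d, ‖x‖ ≤ ρ / 2 → 0 ≤ (ψ x).re := fun x hx => by
    rw [hψφ x hx, Complex.sub_re, hφ0, sub_zero]
    exact hre_nonneg x (hball x hx)
  have hψpos : ∀ x : Space d, ‖x‖ ≤ ρ / 2 → x ≠ 0 → 0 < (ψ x).re := fun x hx hx0 => by
    rw [hψφ x hx, Complex.sub_re, hφ0, sub_zero]
    exact hpos x (hball x hx) hx0
  obtain ⟨hsymm, hpsd⟩ := hessianMatrix_symm_and_nonneg hψ hψ0 hψ1 (hnear.mono hψre)
  have hroots : ∀ μ ∈ (hessianMatrix ψ 0).charpoly.roots, 0 ≤ μ.re ∧ μ ≠ 0 := fun μ hμ =>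
    re_nonneg_and_ne_zero_of_mem_roots hsymm hpsd (by rwa [hH]) hμ
  obtain ⟨F, hFphase, hFr, hFR, hFcoeff⟩ := exists_phaseFamily hψ hψ1 hsymm
    (fun τ hτ => segMatrix_det_ne_zero hroots hτ) (half_pos hρ) hψre hψpos
  -- The velocity `∂Φ/∂τ = ψ - ‖x‖²/2` of the deformation.
  let Θ : ℝ × Space d → ℂ := fun p => (1 : ℂ) * ψ p.2 + (-1 : ℂ) * halfSq p.2
  have hΘ : ContDiff ℝ ∞ Θ :=
    (contDiff_const.mul (contDiff_comp_snd hψ)).add (contDiff_const.mul halfSq_contDiff)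
  have hΘd (k : Fin d) : pderiv k Θ = fun p => (1 : ℂ) * partialDeriv k ψ p.2 +
      (-1 : ℂ) * (p.2 k : ℂ) := by
    have h := pderiv_linearCombination (a := fun _ => 1) (b := fun _ => -1)
      (contDiff_comp_snd hψ) (halfSq_contDiff (d := d)) contDiff_const contDiff_const k
    rwa [pderiv_halfSq, pderiv_comp_snd hψ] at h
  have hΘdd (j k : Fin d) (τ : ℝ) :
      pderiv k (pderiv j Θ) (τ, 0) = (hessianMatrix ψ 0 - 1) k j := by
    have h := pderiv_linearCombination (a := fun _ => 1) (b := fun _ => -1)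
      (contDiff_comp_snd (partialDeriv_contDiff hψ j)) (contDiff_coord (d := d) j)
      contDiff_const contDiff_const k
    rw [hΘd]
    refine (congrFun h (τ, 0)).trans ?_
    beta_reduce
    rw [pderiv_coord, pderiv_comp_snd (partialDeriv_contDiff hψ j)]
    simp only [hessianMatrix, Matrix.sub_apply, Matrix.of_apply, Matrix.one_apply, eq_comm (a := j)]
    ring
  have hΘτ : ∀ τ x, HasDerivAt (fun s : ℝ => F.phase (s, x)) (Θ (τ, x)) τ := fun τ x => by
    rw [hFphase]
    have h := (hasDerivAt_id τ).ofReal_comp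
    convert! ((h.const_sub 1).mul_const (halfSq x)).add (h.mul_const (ψ x)) using 1
    simp [Θ]
    ring
  have hΘ0 : ∀ τ, Θ (τ, 0) = 0 := fun τ => by simp [Θ, hψ0, halfSq]
  have hΘ1 : ∀ τ k, pderiv k Θ (τ, 0) = 0 := fun τ k => by rw [hΘd]; simp [hψ1]
  have hFsymm : ∀ τ ∈ Set.Icc (0 : ℝ) 1, ∀ j k, F.coeff j k (τ, 0) = F.coeff k j (τ, 0) := by
    intro τ hτ j k
    have h : (segMatrix (hessianMatrix ψ 0) τ).transpose = segMatrix (hessianMatrix ψ 0) τ := by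
      ext i l
      simp [segMatrix, hsymm l i, Matrix.one_apply, eq_comm (a := l)]
    have h2 : (segMatrix (hessianMatrix ψ 0) τ)⁻¹.transpose =
        (segMatrix (hessianMatrix ψ 0) τ)⁻¹ := by rw [Matrix.transpose_nonsing_inv, h]
    rw [hFcoeff τ hτ, hFcoeff τ hτ]
    exact congrFun (congrFun h2 k) j
  have hp0 : ∫ τ in (0 : ℝ)..1,
      (1 / 2) * ∑ j, ∑ k, F.coeff j k (τ, 0) * pderiv k (pderiv j Θ) (τ, 0) =
      ∫ τ in (0 : ℝ)..1, 1 / 2 *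
        ((segMatrix (hessianMatrix ψ 0) τ)⁻¹ * (hessianMatrix ψ 0 - 1)).trace := by
    refine intervalIntegral.integral_congr fun τ hτ => ?_
    rw [Set.uIcc_of_le zero_le_one] at hτ
    simp only [hFcoeff τ hτ, hΘdd, Matrix.trace, Matrix.diag_apply, Matrix.mul_apply]
  obtain ⟨δ, hδ, hloc⟩ := F.exists_phaseIntegral_sub_isBigO hFr h𝒩_compact
    (fun x hx => hball x (hx.trans hFR)) hA.continuousOn hφ.continuousOn hpos hφ0
    (u := fun p => a p.2) (fun x hx => haA x (hx.trans hFR))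
    (fun x hx => by simp [hFphase, linPhase, hψφ x (hx.trans hFR)])
  have hgauss := F.osc_zero_sub_gaussian_isBigO hFr fun x => by
    rw [hFphase, ← halfSq_eq]; simp [linPhase]
  have happrox (N : ℕ) : ∃ q : Polynomial ℂ,
      q.coeff 0 = A 0 * (((2 * Real.pi) ^ ((d : ℝ) / 2) : ℝ) : ℂ) / sqrtDet (hessianMatrix φ 0) ∧
      (fun t : ℝ => ((t ^ ((d : ℝ) / 2) : ℝ) : ℂ) *
        (Complex.exp (t * φ 0) * phaseIntegral 𝒩 A φ t) - q.eval ((t : ℂ)⁻¹)) =O[atTop]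
          (fun t : ℝ => (t ^ N)⁻¹) := by
    -- The order `N + d + 1` absorbs the factor `t ^ (d / 2)`, and is positive, so that the
    -- truncated polynomials contain their constant terms.
    obtain ⟨b, -, hb0, C₁, -, hC₁⟩ := F.exists_expansion (N + d + 1) (contDiff_comp_snd ha)
    obtain ⟨p, hp, C₂, -, hC₂⟩ := F.exists_transport hΘ hΘτ hΘ0 hΘ1 hFsymm (N + d + 1)
    have h1 := (hloc.trans (isBigO_exp_neg hδ (N + d + 1))).add
      (isBigO_of_forall_norm_le fun t ht => hC₁ 1 (by simp) t ht)
    have h2 := isBigO_of_forall_norm_le hC₂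
    simp_rw [← truncPoly_eval] at h2
    obtain ⟨q, hq0, hq⟩ := exists_poly_approx
      (I := fun t => Complex.exp (t * φ 0) * phaseIntegral 𝒩 A φ t)
      (b := truncPoly (fun l => b l 1) (N + d + 1)) (Nat.le_succ (N + d))
      (h1.congr_left fun t => by rw [truncPoly_eval]; ring) h2
      (hgauss.trans (isBigO_exp_neg (by positivity) (N + d + 1)))
    refine ⟨q, ?_, hq⟩
    rw [hq0, truncPoly_coeff_zero, truncPoly_coeff_zero, hb0, hp, hp0, Complex.exp_neg,
      exp_integral_trace hroots, haA 0 (by simpa using (half_pos hρ).le), hH]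
    exact (div_eq_mul_inv _ _).symm
  obtain ⟨c, hc0, hc⟩ := exists_asymptotic_coeff happrox
  refine ⟨c, hc0, fun N => ?_⟩
  have h1 : (fun t : ℝ => Complex.exp (-(t : ℂ) * φ 0) * ((t ^ (-(d : ℝ) / 2) : ℝ) : ℂ)) =O[atTop]
      (fun t : ℝ => Complex.exp (-(t : ℂ) * φ 0) * ((t ^ (-(d : ℝ) / 2) : ℝ) : ℂ)) :=
    Asymptotics.isBigO_refl _ _
  have hsplit (l : ℕ) {t : ℝ} (ht : 0 < t) : ((t ^ (-(d : ℝ) / 2 - (l : ℝ)) : ℝ) : ℂ) =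
      ((t ^ (-(d : ℝ) / 2) : ℝ) : ℂ) * ((t : ℂ) ^ l)⁻¹ := by
    rw [Real.rpow_sub ht, Real.rpow_natCast]
    push_cast
    rw [div_eq_mul_inv]
  have h2 : (fun t : ℝ => phaseIntegral 𝒩 A φ t - ∑ n ∈ Finset.range N, c n *
      (Complex.exp (-(t : ℂ) * φ 0) * ((t ^ (-(d : ℝ) / 2 - (n : ℝ)) : ℝ) : ℂ))) =ᶠ[atTop]
      fun t : ℝ => Complex.exp (-(t : ℂ) * φ 0) * ((t ^ (-(d : ℝ) / 2) : ℝ) : ℂ) *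
        (((t ^ ((d : ℝ) / 2) : ℝ) : ℂ) * (Complex.exp (t * φ 0) * phaseIntegral 𝒩 A φ t) -
          ∑ l ∈ Finset.range N, c l * ((t : ℂ) ^ l)⁻¹) := by
    filter_upwards [eventually_gt_atTop 0] with t ht
    have h3 : Complex.exp (-(t : ℂ) * φ 0) * Complex.exp (t * φ 0) = 1 := by
      rw [← Complex.exp_add, neg_mul, neg_add_cancel, Complex.exp_zero]
    have h4 : ((t ^ (-(d : ℝ) / 2) : ℝ) : ℂ) * ((t ^ ((d : ℝ) / 2) : ℝ) : ℂ) = 1 := by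
      rw [← Complex.ofReal_mul, ← Real.rpow_add ht, neg_div, neg_add_cancel, Real.rpow_zero,
        Complex.ofReal_one]
    have h5 : ∑ n ∈ Finset.range N, c n *
        (Complex.exp (-(t : ℂ) * φ 0) * ((t ^ (-(d : ℝ) / 2 - (n : ℝ)) : ℝ) : ℂ)) =
        Complex.exp (-(t : ℂ) * φ 0) * ((t ^ (-(d : ℝ) / 2) : ℝ) : ℂ) *
          ∑ l ∈ Finset.range N, c l * ((t : ℂ) ^ l)⁻¹ := by
      rw [Finset.mul_sum]
      exact Finset.sum_congr rfl fun l _ => by rw [hsplit l ht]; ring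
    rw [h5]
    linear_combination -(phaseIntegral 𝒩 A φ t) * h3 - phaseIntegral 𝒩 A φ t *
      Complex.exp (-(t : ℂ) * φ 0) * Complex.exp (t * φ 0) * h4
  have h6 : (fun t : ℝ => (t ^ N)⁻¹) =O[atTop] (fun t : ℝ => ((t : ℂ) ^ N)⁻¹) :=
    Asymptotics.IsBigO.of_bound 1 (by simp)
  refine (h2.trans_isBigO (h1.mul ((hc N).trans h6))).trans (Asymptotics.IsBigO.of_bound 1 ?_)
  filter_upwards [eventually_gt_atTop 0] with t ht
  rw [hsplit N ht, ← mul_assoc, one_mul]
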